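/- **Setting.** Let $n\ge 0$, $m\ge 1$, and let $f:\mathbb R^n\to\mathbb R$, $c:\mathbb R^n\to\mathbb R^m$ be twice continuously differentiable. Write $z=(x,\lambda)\in\mathbb R^{n+m}$, $\mathcal L(z)=f(x)+\lambda^Tc(x)$, $G(x)$ for the $m\times n$ Jacobian of $c$, $H(z)=\nabla_x^2\mathcal L(z)$, and, for $\eta=(\eta_1,\eta_2)$, $$\mathcal L_\eta(z)=\mathcal L(z)+\tfrac{\eta_1}{2}\|c(x)\|^2+\tfrac{\eta_2}{2}\|\nabla_x\mathcal L(z)\|^2 .$$ Here $\|\cdot\|$ is the Euclidean norm for vectors and the operator norm for matrices, $\nabla$ is the gradient in $z$, $a\vee b=\max\{a,b\}$, $a\wedge b=\min\{a,b\}$, and $\dagger$ is the Moore–Penrose pseudoinverse. **Algorithm (AdaSketch-Newton).** Input: $z_0\in\mathbb R^{n+m}$, $(\theta_k)_{k\ge0}\subseteq(0,1]$, $\eta_{1},\eta_{2},\xi_B>0$, $\delta\in(0,1)$, $\beta\in(0,1/2)$, $\nu>1$, and a backtracking factor $\rho\in(0,1)$. For $k=0,1,2,\dots$, at $z_k=(x_k,\lambda_k)$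 with $G_k=G(x_k)$, $H_k=H(z_k)$, $\nabla\mathcal L_k=\nabla\mathcal L(z_k)$: 1. A symmetric matrix $B_k\in\mathbb R^{n\times n}$ is generated. Let $\Gamma_k=\begin{pmatrix}B_k&G_k^T\\G_k&0\end{pmatrix}$, let $\sigma_{1,k}$ be the least singular value of $G_k$, and let $$\Psi_k=\frac{20(\|B_k\|^2\vee1)}{(\xi_B\wedge1)(\sigma_{1,k}^2\wedge1)},\qquad \Upsilon_k=\|G_k\|\vee\|H_k\|\vee1,\qquad \delta^{\rm trial}_k(\eta)=\frac{(1/2-\beta)\eta_2}{(1+\eta_1+\eta_2)\Upsilon_k^2\Psi_k^2}.$$ 2. Set $\delta\leftarrow\delta\wedge\delta_k^{\rm trial}(\eta)$, $u\leftarrow0$, $j\leftarrow0$, and always write $r=\Gamma_ku+\nabla\mathcal L_k$. Repeat until both (a) $\|r\|\le\theta_k\delta\|\nabla\mathcal L_k\|/(\|\Gamma_k\|\Psi_k)$ and (b) $\nabla\mathcal L_\eta(z_k)^Tu\le-\eta_2\|\nabla\mathcal L_k\|^2/2$ hold: - if (a) fails, set $u\leftarrow u-\Gamma_kS_{k,j}(S_{k,j}^T\Gamma_k^2S_{k,j})^\dagger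 S_{k,j}^Tr$ and $j\leftarrow j+1$; - if (a) holds and (b) fails, set $\eta_1\leftarrow\nu^2\eta_1$, $\eta_2\leftarrow\eta_2/\nu$, and then $\delta\leftarrow(\delta/\nu^4)\wedge\delta_k^{\rm trial}(\eta)$ with the new $\eta$. 3. Let $\alpha_k$ be the first of $1,\rho,\rho^2,\dots$ with $\mathcal L_\eta(z_k+\alpha_ku)\le\mathcal L_\eta(z_k)+\alpha_k\beta\,\nabla\mathcal L_\eta(z_k)^Tu$, and set $z_{k+1}=z_k+\alpha_ku$. The values of $\eta_1,\eta_2,\delta$ are carried over to iteration $k+1$. **Assumptions.** The sketches $S_{k,j}$ ($k,j\ge0$) are random matrices with $n+m$ rows (the number $d$ of columns may be random), and $B_k$ may depend on the outcome. - (A1) There are convex compact sets $\mathcal X\subseteq\mathbb R^n$ and $\Lambda\subseteq\mathbb R^m$ such that, almost surely, every iterate $z_k$ that the algorithm reaches lies in $\mathcal X\times\Lambda$; the second derivatives of $f$ and $c$ are Lipschitz continuous on $\mathcal X$. - (A2) There are constants $\xi_G>0$ and $\Upsilon_B$ such that, almost surely, for every $k$ that the algorithm reaches: $G_kG_k^T\succeq\xi_GI$;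 $B_k$ is symmetric with $\|B_k\|\le\Upsilon_B$; and $u^TB_ku\ge\xi_B\|u\|^2$ for every $u$ with $G_ku=0$, where $\xi_B$ is the input parameter. - (A3) The $S_{k,j}$ are independent and identically distributed copies of a random matrix $S$, and there is $\pi\in(0,1]$ with $P(S^Tu\ne0)\ge\pi$ for every $u\in\mathbb R^{n+m}\setminus\{0\}$. **Theorem.** Under (A1)–(A3), with probability one the algorithm is well defined for all $k$ (in every iteration, step 2 ends after finitely many repetitions and the line search of step 3 finds a stepsize), and $\|\nabla\mathcal L(x_k,\lambda_k)\|\to0$ as $k\to\infty$. -/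

import Mathlib

noncomputable section

namespace AdaSketch

open Matrix

/-! ## Moore–Penrose pseudoinverse of a real matrix -/

/-- The four Penrose equations. -/
def IsMoorePenrose {p q : Type*} [Fintype p] [Fintype q]
    (A : Matrix p q ℝ) (X : Matrix q p ℝ) : Prop :=
  A * X * A = A ∧ X * A * X = X ∧ (A * X)ᵀ = A * X ∧ (X * A)ᵀ = X * A

/-- A symmetric real matrix has a symmetric Moore–Penrose inverse that commutes with it. -/
theorem exists_isMoorePenrose_of_isSymm {q : Type*} [Fintype q] [DecidableEq q]
    (A : Matrix q q ℝ) (hA : A.IsHermitian) :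
    ∃ X : Matrix q q ℝ, IsMoorePenrose A X ∧ Xᵀ = X ∧ A * X = X * A := by
  set U : Matrix q q ℝ := (hA.eigenvectorUnitary : Matrix q q ℝ) with hU
  have hUU : Uᵀ * U = 1 := by
    have h := Unitary.coe_star_mul_self hA.eigenvectorUnitary
    simpa [Matrix.star_eq_conjTranspose, Matrix.conjTranspose_eq_transpose_of_trivial] using h
  set D : Matrix q q ℝ := Matrix.diagonal hA.eigenvalues with hD
  have hAe : A = U * D * Uᵀ := by
    have h := hA.spectral_theorem
    rw [Unitary.conjStarAlgAut_apply] at h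
    simpa [Matrix.star_eq_conjTranspose, Matrix.conjTranspose_eq_transpose_of_trivial,
      Function.comp_def] using h
  set E : Matrix q q ℝ := Matrix.diagonal (fun i => (hA.eigenvalues i)⁻¹) with hE
  have mulUU : ∀ P Q : Matrix q q ℝ, (U * P * Uᵀ) * (U * Q * Uᵀ) = U * (P * Q) * Uᵀ := by
    intro P Q
    calc (U * P * Uᵀ) * (U * Q * Uᵀ) = U * P * (Uᵀ * U) * Q * Uᵀ := by
          simp only [Matrix.mul_assoc]
      _ = U * (P * Q) * Uᵀ := by rw [hUU]; simp only [Matrix.mul_one, Matrix.mul_assoc]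
  have hDE : D * E = E * D := by
    simp [hD, hE, Matrix.diagonal_mul_diagonal, mul_comm]
  have hDED : D * E * D = D := by
    simp [hD, hE, Matrix.diagonal_mul_diagonal, mul_inv_mul_cancel]
  have hEDE : E * D * E = E := by
    simp only [hD, hE, Matrix.diagonal_mul_diagonal]
    congr 1
    funext i
    simpa using mul_inv_mul_cancel (hA.eigenvalues i)⁻¹
  have hDt : Dᵀ = D := by simp [hD]
  have hEt : Eᵀ = E := by simp [hE]
  have hsymm : ∀ P : Matrix q q ℝ, Pᵀ = P → (U * P * Uᵀ)ᵀ = U * P * Uᵀ := by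
    intro P hP
    simp [Matrix.transpose_mul, hP, Matrix.mul_assoc]
  have hDEt : (D * E)ᵀ = D * E := by rw [Matrix.transpose_mul, hDt, hEt, hDE]
  have hEDt : (E * D)ᵀ = E * D := by rw [Matrix.transpose_mul, hDt, hEt, hDE]
  refine ⟨U * E * Uᵀ, ⟨?_, ?_, ?_, ?_⟩, hsymm E hEt, ?_⟩
  · rw [hAe, mulUU, mulUU, hDED]
  · rw [hAe, mulUU, mulUU, hEDE]
  · rw [hAe, mulUU]; exact hsymm _ hDEt
  · rw [hAe, mulUU]; exact hsymm _ hEDt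
  · rw [hAe, mulUU, mulUU, hDE]

/-- Every real matrix has a Moore–Penrose inverse. -/
theorem exists_isMoorePenrose {p q : Type*} [Fintype p] [Fintype q]
    (A : Matrix p q ℝ) : ∃ X : Matrix q p ℝ, IsMoorePenrose A X := by
  classical
  have hM : (Aᵀ * A).IsHermitian := by
    rw [← Matrix.conjTranspose_eq_transpose_of_trivial]
    exact Matrix.isHermitian_conjTranspose_mul_self A
  obtain ⟨Y, ⟨h1, h2, h3, h4⟩, hYt, hc⟩ := exists_isMoorePenrose_of_isSymm (Aᵀ * A) hM
  have hker : A * (Y * (Aᵀ * A)) = A := by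
    have h0 : (A * (Y * (Aᵀ * A)) - A)ᵀ * (A * (Y * (Aᵀ * A)) - A) = 0 := by
      have e : A * (Y * (Aᵀ * A)) - A = A * (Y * (Aᵀ * A) - 1) := by
        rw [Matrix.mul_sub, Matrix.mul_one]
      have e2 : Aᵀ * A * (Y * (Aᵀ * A) - 1) = 0 := by
        rw [Matrix.mul_sub, Matrix.mul_one, ← Matrix.mul_assoc, h1, sub_self]
      rw [e, Matrix.transpose_mul]
      calc (Y * (Aᵀ * A) - 1)ᵀ * Aᵀ * (A * (Y * (Aᵀ * A) - 1))
          = (Y * (Aᵀ * A) - 1)ᵀ * (Aᵀ * A * (Y * (Aᵀ * A) - 1)) := by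
            simp only [Matrix.mul_assoc]
        _ = 0 := by rw [e2, Matrix.mul_zero]
    rw [← Matrix.conjTranspose_eq_transpose_of_trivial,
      Matrix.conjTranspose_mul_self_eq_zero] at h0
    exact sub_eq_zero.mp h0
  refine ⟨Y * Aᵀ, ?_, ?_, ?_, ?_⟩
  · simpa only [Matrix.mul_assoc] using hker
  · calc Y * Aᵀ * A * (Y * Aᵀ) = (Y * (Aᵀ * A) * Y) * Aᵀ := by simp only [Matrix.mul_assoc]
      _ = Y * Aᵀ := by rw [h2]
  · simp [Matrix.transpose_mul, hYt, Matrix.mul_assoc]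
  · rw [Matrix.mul_assoc]; exact h4

/-- The Moore–Penrose pseudoinverse `A†`: the (unique) solution of the Penrose equations. -/
def pinv {p q : Type*} [Fintype p] [Fintype q] (A : Matrix p q ℝ) : Matrix q p ℝ :=
  Classical.choose (exists_isMoorePenrose A)

/-! ## Matrix quantities -/

/-- The operator norm of a real matrix with respect to the Euclidean norms. -/
def opNorm {p q : Type*} [Fintype p] [Fintype q] [DecidableEq q] (A : Matrix p q ℝ) : ℝ :=
  ‖LinearMap.toContinuousLinearMap (Matrix.toEuclideanLin A)‖

/-- The least singular value of an `m × n` matrix `G` with `m ≤ n`: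
the minimum of `‖Gᵀ y‖` over unit vectors `y ∈ ℝᵐ`. -/
def leastSingularValue {n m : ℕ} (G : Matrix (Fin m) (Fin n) ℝ) : ℝ :=
  ⨅ y : Metric.sphere (0 : EuclideanSpace ℝ (Fin m)) 1,
    ‖Matrix.toEuclideanLin Gᵀ (y : EuclideanSpace ℝ (Fin m))‖

/-! ## The problem `min f(x)` subject to `c(x) = 0`, and its Lagrangian -/

/-- The primal-dual space `ℝⁿ⁺ᵐ` of pairs `z = (x, λ)`, with its Euclidean norm. -/
abbrev PD (n m : ℕ) : Type := EuclideanSpace ℝ (Fin n ⊕ Fin m)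

/-- The primal component `x` of `z = (x, λ)`. -/
def primal {n m : ℕ} (z : PD n m) : EuclideanSpace ℝ (Fin n) :=
  WithLp.toLp 2 fun i => z (Sum.inl i)

/-- The dual component `λ` of `z = (x, λ)`. -/
def dual {n m : ℕ} (z : PD n m) : EuclideanSpace ℝ (Fin m) :=
  WithLp.toLp 2 fun i => z (Sum.inr i)

section Problem

variable {n m : ℕ} (f : EuclideanSpace ℝ (Fin n) → ℝ)
  (c : EuclideanSpace ℝ (Fin n) → EuclideanSpace ℝ (Fin m))

/-- `L(x, l) = f(x) + lᵀ c(x)`. -/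
def lagr (x : EuclideanSpace ℝ (Fin n)) (l : EuclideanSpace ℝ (Fin m)) : ℝ :=
  f x + ∑ i, l i * c x i

/-- The Lagrangian as a function of `z = (x, λ)`. -/
def lagrangian (z : PD n m) : ℝ := lagr f c (primal z) (dual z)

/-- `∇L(x, λ)`, the KKT residual vector: the gradient in all of `z = (x, λ)`. -/
def gradL (z : PD n m) : PD n m := gradient (lagrangian f c) z

/-- `∇ₓL(x, λ)`. -/
def gradX (z : PD n m) : EuclideanSpace ℝ (Fin n) :=
  gradient (fun x => lagr f c x (dual z)) (primal z)

/-- The constraint Jacobian `G(x)`, an `m × n` matrix. -/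
def jacobian (x : EuclideanSpace ℝ (Fin n)) : Matrix (Fin m) (Fin n) ℝ :=
  Matrix.of fun i j => fderiv ℝ c x (EuclideanSpace.single j 1) i

/-- The Hessian `H(x, λ) = ∇ₓ²L(x, λ)`. -/
def hessian (z : PD n m) : Matrix (Fin n) (Fin n) ℝ :=
  Matrix.of fun i j =>
    fderiv ℝ (fderiv ℝ (fun x => lagr f c x (dual z))) (primal z)
      (EuclideanSpace.single i 1) (EuclideanSpace.single j 1)

/-- The exact augmented Lagrangian
`L_η(z) = L(z) + η₁/2 ‖c(x)‖² + η₂/2 ‖∇ₓL(z)‖²`. -/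
def merit (η₁ η₂ : ℝ) (z : PD n m) : ℝ :=
  lagrangian f c z + η₁ / 2 * ‖c (primal z)‖ ^ 2 + η₂ / 2 * ‖gradX f c z‖ ^ 2

/-- `∇L_η(z)`, the gradient in all of `z`. -/
def gradMerit (η₁ η₂ : ℝ) (z : PD n m) : PD n m := gradient (merit f c η₁ η₂) z

end Problem

/-- The KKT matrix `Γ = [B Gᵀ; G 0]`. -/
def kktMatrix {n m : ℕ} (B : Matrix (Fin n) (Fin n) ℝ) (G : Matrix (Fin m) (Fin n) ℝ) :
    Matrix (Fin n ⊕ Fin m) (Fin n ⊕ Fin m) ℝ :=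
  Matrix.fromBlocks B Gᵀ G 0

/-! ## Sketching -/

/-- The Borel (product) σ-algebra on a space of real matrices. -/
instance matrixMeasurableSpace {p q : Type*} : MeasurableSpace (Matrix p q ℝ) :=
  inferInstanceAs (MeasurableSpace (p → q → ℝ))

/-- A sketching matrix with `n + m` rows; its number `d` of columns may vary. -/
abbrev Sketch (n m : ℕ) : Type := Σ d : ℕ, Matrix (Fin n ⊕ Fin m) (Fin d) ℝ

/-- The residual `r = Γ u + g` of the Newton system `Γ u = -g`. -/
def newtonResidual {n m : ℕ} (Γ : Matrix (Fin n ⊕ Fin m) (Fin n ⊕ Fin m) ℝ) (g u : PD n m) : PD n m :=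
  Matrix.toEuclideanLin Γ u + g

/-- One iteration `u ↦ u - Γ S (Sᵀ Γ² S)† Sᵀ r` of the sketching solver. -/
def sketchStep {n m : ℕ} (Γ : Matrix (Fin n ⊕ Fin m) (Fin n ⊕ Fin m) ℝ) (g : PD n m)
    (s : Sketch n m) (u : PD n m) : PD n m :=
  u - Matrix.toEuclideanLin (Γ * s.2 * pinv (s.2ᵀ * (Γ * Γ) * s.2) * s.2ᵀ) (newtonResidual Γ g u)

/-! ## The algorithm -/

/-- The input of the algorithm. `ρ` is the reduction factor of the backtracking line search. -/
structure Input (n m : ℕ) where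
  z₀ : PD n m
  θ : ℕ → ℝ
  η₁₀ : ℝ
  η₂₀ : ℝ
  ξB : ℝ
  δ₀ : ℝ
  β : ℝ
  ν : ℝ
  ρ : ℝ
  θ_mem : ∀ k, θ k ∈ Set.Ioc (0 : ℝ) 1
  η₁₀_pos : 0 < η₁₀
  η₂₀_pos : 0 < η₂₀
  ξB_pos : 0 < ξB
  δ₀_mem : δ₀ ∈ Set.Ioo (0 : ℝ) 1
  β_mem : β ∈ Set.Ioo (0 : ℝ) (1 / 2)
  one_lt_ν : 1 < ν
  ρ_mem : ρ ∈ Set.Ioo (0 : ℝ) 1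

/-- What is carried from one outer iteration to the next. -/
structure State (n m : ℕ) where
  z : PD n m
  η₁ : ℝ
  η₂ : ℝ
  δ : ℝ

/-- What changes within an outer iteration: the number `j` of sketches used so far, the current
inexact direction `u`, and the adaptive parameters. -/
structure InnerState (n m : ℕ) where
  j : ℕ
  u : PD n m
  η₁ : ℝ
  η₂ : ℝ
  δ : ℝ

section Algorithm

variable {n m : ℕ} (f : EuclideanSpace ℝ (Fin n) → ℝ)
  (c : EuclideanSpace ℝ (Fin n) → EuclideanSpace ℝ (Fin m)) (p : Input n m)

/-- `Ψ = 20 (‖B‖² ∨ 1) / ((ξ_B ∧ 1) (σ₁² ∧ 1))` with `σ₁` the least singular value of `G`. -/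
def psi (z : PD n m) (B : Matrix (Fin n) (Fin n) ℝ) : ℝ :=
  20 * max (opNorm B ^ 2) 1 /
    (min p.ξB 1 * min (leastSingularValue (jacobian c (primal z)) ^ 2) 1)

/-- `Υ = ‖G‖ ∨ ‖H‖ ∨ 1`. -/
def upsilon (z : PD n m) : ℝ :=
  max (max (opNorm (jacobian c (primal z))) (opNorm (hessian f c z))) 1

/-- `δ^trial = (0.5 - β) η₂ / ((1 + η₁ + η₂) Υ² Ψ²)`. -/
def deltaTrial (z : PD n m) (B : Matrix (Fin n) (Fin n) ℝ) (η₁ η₂ : ℝ) : ℝ :=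
  (1 / 2 - p.β) * η₂ / ((1 + η₁ + η₂) * upsilon f c z ^ 2 * psi c p z B ^ 2)

/-- The adaptive accuracy condition `‖r‖ ≤ θ_k δ ‖∇L‖ / (‖Γ‖ Ψ)`. -/
def AccuracyCond (k : ℕ) (z : PD n m) (B : Matrix (Fin n) (Fin n) ℝ) (w : InnerState n m) : Prop :=
  ‖newtonResidual (kktMatrix B (jacobian c (primal z))) (gradL f c z) w.u‖ ≤
    p.θ k * w.δ * ‖gradL f c z‖ /
      (opNorm (kktMatrix B (jacobian c (primal z))) * psi c p z B)

/-- The descent direction condition `∇L_ηᵀ u ≤ -η₂ ‖∇L‖² / 2`. -/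
def DescentCond (z : PD n m) (w : InnerState n m) : Prop :=
  inner ℝ (gradMerit f c w.η₁ w.η₂ z) w.u ≤ -(w.η₂ * ‖gradL f c z‖ ^ 2 / 2)

/-- The start of outer iteration `k`: zero direction, `δ ← δ ∧ δ^trial`. -/
def innerInit (B : Matrix (Fin n) (Fin n) ℝ) (s : State n m) : InnerState n m where
  j := 0
  u := 0
  η₁ := s.η₁
  η₂ := s.η₂
  δ := min s.δ (deltaTrial f c p s.z B s.η₁ s.η₂)

open Classical in
/-- One elementary step of the two nested while loops of outer iteration `k` at the iterate `z`,
with the sketches `S 0, S 1, …`. If the accuracy condition fails, a new sketch updates the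
direction; if it holds and the descent condition fails, the parameters are updated; if both hold,
the loops have ended. -/
def innerStep (k : ℕ) (z : PD n m) (B : Matrix (Fin n) (Fin n) ℝ) (S : ℕ → Sketch n m)
    (w : InnerState n m) : InnerState n m :=
  if AccuracyCond f c p k z B w then
    if DescentCond f c z w then w
    else
      { w with
        η₁ := w.η₁ * p.ν ^ 2
        η₂ := w.η₂ / p.ν
        δ := min (w.δ / p.ν ^ 4) (deltaTrial f c p z B (w.η₁ * p.ν ^ 2) (w.η₂ / p.ν)) }
  else
    { w with
      j := w.j + 1
      u := sketchStep (kktMatrix B (jacobian c (primal z))) (gradL f c z) (S w.j) w.u }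

/-- The state of the nested while loops after `t` elementary steps. -/
def innerIter (k : ℕ) (B : Matrix (Fin n) (Fin n) ℝ) (S : ℕ → Sketch n m) (s : State n m)
    (t : ℕ) : InnerState n m :=
  (innerStep f c p k s.z B S)^[t] (innerInit f c p B s)

/-- The step acceptance condition after `t` elementary steps. -/
def Accepted (k : ℕ) (B : Matrix (Fin n) (Fin n) ℝ) (S : ℕ → Sketch n m) (s : State n m)
    (t : ℕ) : Prop :=
  AccuracyCond f c p k s.z B (innerIter f c p k B S s t) ∧
    DescentCond f c s.z (innerIter f c p k B S s t)

/-- The Armijo condition for the stepsize `α` along the accepted direction `w.u`. -/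
def Armijo (z : PD n m) (w : InnerState n m) (α : ℝ) : Prop :=
  merit f c w.η₁ w.η₂ (z + α • w.u) ≤
    merit f c w.η₁ w.η₂ z + α * p.β * inner ℝ (gradMerit f c w.η₁ w.η₂ z) w.u

open Classical in
/-- One outer iteration. The result is `none` if the nested while loops or the line search do not
terminate. The stepsize is the first of `1, ρ, ρ², …` that satisfies the Armijo condition. -/
def outerStep (k : ℕ) (B : Matrix (Fin n) (Fin n) ℝ) (S : ℕ → Sketch n m) (s : State n m) :
    Option (State n m) :=
  if h : ∃ t, Accepted f c p k B S s t then
    let w := innerIter f c p k B S s (Nat.find h)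
    if h' : ∃ i : ℕ, Armijo f c p s.z w (p.ρ ^ i) then
      some { z := s.z + p.ρ ^ Nat.find h' • w.u, η₁ := w.η₁, η₂ := w.η₂, δ := w.δ }
    else none
  else none

/-- The state at the start of outer iteration `k`, where `B k` is the modified Hessian generated
in iteration `k` and `S k j` are the sketches of iteration `k`. It is `none` if the algorithm does
not reach iteration `k`. -/
def run (B : ℕ → Matrix (Fin n) (Fin n) ℝ) (S : ℕ → ℕ → Sketch n m) : ℕ → Option (State n m)
  | 0 => some { z := p.z₀, η₁ := p.η₁₀, η₂ := p.η₂₀, δ := p.δ₀ }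
  | k + 1 => (run B S k).bind (outerStep f c p k (B k) (S k))

end Algorithm

end AdaSketch

end

noncomputable section

namespace AdaSketch

open Matrix

/-! ## The sketching solver -/

section Projection

variable {p q : Type*} [Fintype p] [Fintype q]

theorem toEuclideanLin_mul_apply {p q r : Type*} [Fintype q] [Fintype r]
    [DecidableEq q] [DecidableEq r] (A : Matrix p q ℝ)
    (B : Matrix q r ℝ) (x : EuclideanSpace ℝ r) :
    toEuclideanLin (A * B) x = toEuclideanLin A (toEuclideanLin B x) := by
  simp [toLpLin_apply, mulVec_mulVec]

theorem inner_toEuclideanLin_left [DecidableEq p] [DecidableEq q] (A : Matrix p q ℝ)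
    (x : EuclideanSpace ℝ q) (y : EuclideanSpace ℝ p) :
    inner ℝ (toEuclideanLin A x) y = inner ℝ x (toEuclideanLin Aᵀ y) := by
  have h := toEuclideanLin_conjTranspose_eq_adjoint A
  rw [conjTranspose_eq_transpose_of_trivial] at h
  rw [h, LinearMap.adjoint_inner_right]

theorem norm_toEuclideanLin_le [DecidableEq q] (A : Matrix p q ℝ) (x : EuclideanSpace ℝ q) :
    ‖toEuclideanLin A x‖ ≤ opNorm A * ‖x‖ :=
  (LinearMap.toContinuousLinearMap (toEuclideanLin A)).le_opNorm x

/-- The orthogonal projection onto the range of `A`. -/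
def rangeProj (A : Matrix p q ℝ) : Matrix p p ℝ := A * pinv (Aᵀ * A) * Aᵀ

theorem mul_gram_inverse_mul_gram (A : Matrix p q ℝ) (Y : Matrix q q ℝ)
    (hY : Aᵀ * A * Y * (Aᵀ * A) = Aᵀ * A) : A * Y * (Aᵀ * A) = A := by
  classical
  have h0 : (A * Y * (Aᵀ * A) - A)ᵀ * (A * Y * (Aᵀ * A) - A) = 0 := by
    have e : A * Y * (Aᵀ * A) - A = A * (Y * (Aᵀ * A) - 1) := by
      rw [Matrix.mul_sub, Matrix.mul_one, Matrix.mul_assoc]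
    have e2 : Aᵀ * A * (Y * (Aᵀ * A) - 1) = 0 := by
      rw [Matrix.mul_sub, Matrix.mul_one, ← Matrix.mul_assoc, hY, sub_self]
    rw [e, Matrix.transpose_mul]
    calc (Y * (Aᵀ * A) - 1)ᵀ * Aᵀ * (A * (Y * (Aᵀ * A) - 1))
        = (Y * (Aᵀ * A) - 1)ᵀ * (Aᵀ * A * (Y * (Aᵀ * A) - 1)) := by
          simp only [Matrix.mul_assoc]
      _ = 0 := by rw [e2, Matrix.mul_zero]
  rw [← Matrix.conjTranspose_eq_transpose_of_trivial,
    Matrix.conjTranspose_mul_self_eq_zero] at h0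
  exact sub_eq_zero.mp h0

theorem rangeProj_transpose_mul (A : Matrix p q ℝ) : (rangeProj A)ᵀ * A = A := by
  have hY : Aᵀ * A * pinv (Aᵀ * A) * (Aᵀ * A) = Aᵀ * A :=
    (Classical.choose_spec (exists_isMoorePenrose (Aᵀ * A))).1
  have hYt := congrArg transpose hY
  have h := mul_gram_inverse_mul_gram A (pinv (Aᵀ * A))ᵀ (by
    simpa [Matrix.transpose_mul, Matrix.mul_assoc] using hYt)
  simpa [rangeProj, Matrix.transpose_mul, Matrix.mul_assoc] using h

theorem rangeProj_transpose_mul_self (A : Matrix p q ℝ) :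
    (rangeProj A)ᵀ * rangeProj A = rangeProj A := by
  have h : rangeProj A = A * (pinv (Aᵀ * A) * Aᵀ) := by rw [rangeProj, Matrix.mul_assoc]
  conv_lhs => rw [h, ← Matrix.mul_assoc, ← h, rangeProj_transpose_mul, ← h]

theorem norm_sub_rangeProj_sq [DecidableEq p] (A : Matrix p q ℝ) (e : EuclideanSpace ℝ p) :
    ‖e - toEuclideanLin (rangeProj A) e‖ ^ 2 = ‖e‖ ^ 2 - ‖toEuclideanLin (rangeProj A) e‖ ^ 2 := by
  have h : inner ℝ e (toEuclideanLin (rangeProj A) e)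
      = ‖toEuclideanLin (rangeProj A) e‖ ^ 2 := by
    rw [← real_inner_self_eq_norm_sq, inner_toEuclideanLin_left, ← toEuclideanLin_mul_apply,
      rangeProj_transpose_mul_self]
  rw [norm_sub_sq_real, h]
  ring

theorem transpose_apply_rangeProj [DecidableEq p] (A : Matrix p q ℝ)
    (e : EuclideanSpace ℝ p) :
    toEuclideanLin Aᵀ (toEuclideanLin (rangeProj A) e) = toEuclideanLin Aᵀ e := by
  have h := congrArg transpose (rangeProj_transpose_mul A)
  rw [transpose_mul, transpose_transpose] at h
  rw [← toEuclideanLin_mul_apply, h]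

end Projection

/-- If the steps of a sequence tend to zero, and arbitrarily late windows of bounded length
contain an operator that sees the start of the window, but sees each point only as much as
the step there, then the sequence comes arbitrarily close to the kernel of `T`. -/
theorem exists_norm_le_of_windows {V W : Type*} [NormedAddCommGroup V] [NormedAddCommGroup W]
    [NormedSpace ℝ V] [NormedSpace ℝ W]
    (e d : ℕ → V) (hed : ∀ t, e (t + 1) = e t - d t)
    (hd : Filter.Tendsto (fun t => ‖d t‖) Filter.atTop (nhds 0))
    (T : V →L[ℝ] W) (σ : ℕ → W → ℝ) (hσ : ∀ t x y, σ t (x + y) ≤ σ t x + σ t y)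
    (M : ℕ) (K κ : ℝ) (hκ : 0 < κ) (hK : 0 ≤ K)
    (hwin : ∀ Q, ∃ q ≥ Q, ∀ v, v ≠ 0 → ∃ i < M, (∀ x, σ (q + i) x ≤ K * ‖x‖) ∧ κ * ‖v‖ ≤ σ (q + i) v)
    (hstep : ∀ t, (∀ x, σ t x ≤ K * ‖x‖) → σ t (T (e t)) ≤ K * ‖T‖ * ‖d t‖)
    (ε : ℝ) (hε : 0 < ε) : ∃ t, ‖T (e t)‖ ≤ ε := by
  set τ : ℝ := κ * ε / (K * ‖T‖ * (M + 1) + 1) with hτ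
  have hden : 0 < K * ‖T‖ * (M + 1) + 1 := by positivity
  have hτpos : 0 < τ := by positivity
  obtain ⟨Q, hQ⟩ := Filter.eventually_atTop.mp (hd.eventually (ge_mem_nhds hτpos))
  obtain ⟨q, hqQ, hq⟩ := hwin Q
  by_cases h0 : T (e q) = 0
  · exact ⟨q, by rw [h0, norm_zero]; exact hε.le⟩
  obtain ⟨i, hi, hb, hv⟩ := hq (T (e q)) h0
  have hdrift : ∀ i : ℕ, ‖e q - e (q + i)‖ ≤ i * τ := by
    intro i
    induction i with
    | zero => simp
    | succ i ih =>
      have h1 : e q - e (q + (i + 1)) = (e q - e (q + i)) + d (q + i) := by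
        rw [← add_assoc, hed]; abel
      rw [h1]
      calc _ ≤ ‖e q - e (q + i)‖ + ‖d (q + i)‖ := norm_add_le _ _
        _ ≤ i * τ + τ := add_le_add ih (hQ _ (by omega))
        _ = _ := by push_cast; ring
  refine ⟨q, ?_⟩
  have h1 : T (e q) = T (e q - e (q + i)) + T (e (q + i)) := by rw [← map_add, sub_add_cancel]
  have h2 : σ (q + i) (T (e q - e (q + i))) ≤ K * (‖T‖ * (M * τ)) := by
    refine (hb _).trans (mul_le_mul_of_nonneg_left ?_ hK)
    refine (T.le_opNorm _).trans (mul_le_mul_of_nonneg_left ?_ (norm_nonneg _))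
    refine (hdrift i).trans (mul_le_mul_of_nonneg_right ?_ hτpos.le)
    exact_mod_cast hi.le
  have h3 : σ (q + i) (T (e (q + i))) ≤ K * ‖T‖ * τ :=
    (hstep _ hb).trans (mul_le_mul_of_nonneg_left (hQ _ (by omega)) (by positivity))
  have h4 : κ * ‖T (e q)‖ ≤ K * (‖T‖ * (M * τ)) + K * ‖T‖ * τ := by
    refine hv.trans ?_
    conv_lhs => rw [h1]
    exact (hσ _ _ _).trans (add_le_add h2 h3)
  have h5 : (K * ‖T‖ * (M + 1) + 1) * τ = κ * ε := by rw [hτ]; field_simp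
  have h6 : κ * ‖T (e q)‖ ≤ κ * ε := by rw [← h5]; linarith
  exact le_of_mul_le_mul_left h6 hκ

/-- A sequence of sketches is recurrent if arbitrarily late windows of bounded length jointly
see every direction, with uniform bounds. -/
def Recurrent {n m : ℕ} (S : ℕ → Sketch n m) : Prop :=
  ∃ (M : ℕ) (K κ : ℝ), 0 ≤ K ∧ 0 < κ ∧ ∀ Q, ∃ q ≥ Q, ∀ v : PD n m, v ≠ 0 → ∃ i < M,
    (∀ x : PD n m, ‖toEuclideanLin (S (q + i)).2ᵀ x‖ ≤ K * ‖x‖) ∧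
      κ * ‖v‖ ≤ ‖toEuclideanLin (S (q + i)).2ᵀ v‖

theorem sketchStep_sub {n m : ℕ} {Γ : Matrix (Fin n ⊕ Fin m) (Fin n ⊕ Fin m) ℝ} {g us : PD n m}
    (hΓ : Γ.IsSymm) (hus : toEuclideanLin Γ us = -g) (s : Sketch n m) (u : PD n m) :
    sketchStep Γ g s u - us =
      (u - us) - toEuclideanLin (rangeProj (Γ * s.2)) (u - us) := by
  have h1 : newtonResidual Γ g u = toEuclideanLin Γ (u - us) := by
    rw [newtonResidual, map_sub, hus, sub_neg_eq_add]
  have h2 : rangeProj (Γ * s.2) = Γ * s.2 * pinv (s.2ᵀ * (Γ * Γ) * s.2) * s.2ᵀ * Γ := by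
    simp only [rangeProj, transpose_mul, hΓ.eq, Matrix.mul_assoc]
  rw [sketchStep, h1, h2, toEuclideanLin_mul_apply _ Γ]
  abel

theorem Recurrent.exists_residual_le {n m : ℕ} {S : ℕ → Sketch n m} (hS : Recurrent S)
    {Γ : Matrix (Fin n ⊕ Fin m) (Fin n ⊕ Fin m) ℝ} {g us : PD n m}
    (hΓ : Γ.IsSymm) (hus : toEuclideanLin Γ us = -g) (j : ℕ) (u : ℕ → PD n m)
    (hu : ∀ t, u (t + 1) = sketchStep Γ g (S (j + t)) (u t)) {ε : ℝ} (hε : 0 < ε) :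
    ∃ t, ‖newtonResidual Γ g (u t)‖ ≤ ε := by
  obtain ⟨M, K, κ, hK, hκ, hwin⟩ := hS
  set e : ℕ → PD n m := fun t => u t - us with he
  set d : ℕ → PD n m := fun t => toEuclideanLin (rangeProj (Γ * (S (j + t)).2)) (e t) with hd
  have hed : ∀ t, e (t + 1) = e t - d t := by
    intro t
    simp only [he, hd]
    rw [hu, sketchStep_sub hΓ hus]
  have hsq : ∀ t, ‖e (t + 1)‖ ^ 2 = ‖e t‖ ^ 2 - ‖d t‖ ^ 2 := by
    intro t
    rw [hed, hd, norm_sub_rangeProj_sq]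
  have hanti : Antitone fun t => ‖e t‖ ^ 2 :=
    antitone_nat_of_succ_le fun t => by rw [hsq]; linarith [sq_nonneg ‖d t‖]
  have hlim := tendsto_atTop_ciInf hanti ⟨0, by rintro _ ⟨t, rfl⟩; positivity⟩
  have hd2 : Filter.Tendsto (fun t => ‖d t‖ ^ 2) Filter.atTop (nhds 0) := by
    have h := hlim.sub (hlim.comp (Filter.tendsto_add_atTop_nat 1))
    rw [sub_self] at h
    refine h.congr fun t => ?_
    simp only [Function.comp_apply, hsq]
    ring
  have hd0 : Filter.Tendsto (fun t => ‖d t‖) Filter.atTop (nhds 0) := by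
    have h := hd2.sqrt
    simpa [Real.sqrt_sq] using h
  obtain ⟨t, ht⟩ := exists_norm_le_of_windows e d hed hd0
    (LinearMap.toContinuousLinearMap (toEuclideanLin Γ))
    (fun t x => ‖toEuclideanLin (S (j + t)).2ᵀ x‖)
    (fun t x y => by simpa using norm_add_le _ _) M K κ hκ hK
    (fun Q => by
      obtain ⟨q, hq, h⟩ := hwin (j + Q)
      refine ⟨q - j, by omega, fun v hv => ?_⟩
      obtain ⟨i, hi, h1, h2⟩ := h v hv
      refine ⟨i, hi, ?_⟩
      have : j + (q - j + i) = q + i := by omega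
      rw [this]
      exact ⟨h1, h2⟩)
    (fun t hb => by
      have h1 : toEuclideanLin (S (j + t)).2ᵀ (toEuclideanLin Γ (e t))
          = toEuclideanLin (S (j + t)).2ᵀ (toEuclideanLin Γ (d t)) := by
        have h := transpose_apply_rangeProj (Γ * (S (j + t)).2) (e t)
        rw [transpose_mul, hΓ.eq, toEuclideanLin_mul_apply, toEuclideanLin_mul_apply] at h
        exact h.symm
      simp only [LinearMap.coe_toContinuousLinearMap']
      rw [h1, mul_assoc]
      exact (hb _).trans (mul_le_mul_of_nonneg_left
        ((LinearMap.toContinuousLinearMap (toEuclideanLin Γ)).le_opNorm _) hK))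
    ε hε
  refine ⟨t, ?_⟩
  have : newtonResidual Γ g (u t) = toEuclideanLin Γ (e t) := by
    rw [newtonResidual, he, map_sub, hus, sub_neg_eq_add]
  rw [this]
  exact ht

/-! ## Almost every sequence of independent sketches is recurrent -/

section Probability

open MeasureTheory ProbabilityTheory

section Sketches

variable {n m : ℕ}

/-- The sum of the absolute values of the entries of a sketch. -/
def entrySum (s : Sketch n m) : ℝ := ∑ j, ∑ i, |s.2 i j|

theorem measurable_of_comp_sigmaMk {β : Type*} [MeasurableSpace β] {φ : Sketch n m → β}
    (h : ∀ d, Measurable fun A : Matrix (Fin n ⊕ Fin m) (Fin d) ℝ => φ ⟨d, A⟩) :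
    Measurable φ := by
  intro s hs
  rw [MeasurableSpace.measurableSet_iInf]
  exact fun d => h d hs

theorem measurable_entry {p q : Type*} (i : p) (j : q) :
    Measurable fun A : Matrix p q ℝ => A i j :=
  (measurable_pi_apply j).comp (measurable_pi_apply (X := fun _ : p => q → ℝ) i)

theorem measurable_entrySum : Measurable (entrySum (n := n) (m := m)) :=
  measurable_of_comp_sigmaMk fun d => by
    change Measurable fun A : Matrix (Fin n ⊕ Fin m) (Fin d) ℝ => ∑ j : Fin d, ∑ i, |A i j|
    refine Finset.measurable_fun_sum _ fun j _ => Finset.measurable_fun_sum _ fun i _ => ?_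
    exact (measurable_entry i j).norm

theorem measurable_norm_transpose_apply (v : PD n m) :
    Measurable fun s : Sketch n m => ‖toEuclideanLin s.2ᵀ v‖ :=
  measurable_of_comp_sigmaMk fun d => by
    simp only [EuclideanSpace.norm_eq, toLpLin_apply, mulVec, dotProduct, transpose_apply]
    change Measurable fun A : Matrix (Fin n ⊕ Fin m) (Fin d) ℝ =>
      √(∑ j : Fin d, ‖∑ i, A i j * v.ofLp i‖ ^ 2)
    refine Measurable.sqrt (Finset.measurable_fun_sum _ fun j _ => ?_)
    refine Measurable.pow_const ?_ 2
    exact (Finset.measurable_fun_sum _ fun i _ => (measurable_entry i j).mul_const _).norm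

theorem norm_transpose_apply_le (s : Sketch n m) (x : PD n m) :
    ‖toEuclideanLin s.2ᵀ x‖ ≤ entrySum s * ‖x‖ := by
  have h1 : toEuclideanLin s.2ᵀ x
      = ∑ j, EuclideanSpace.single j (toEuclideanLin s.2ᵀ x j) := by
    ext j
    simp [Finset.sum_apply]
  rw [h1, entrySum, Finset.sum_mul]
  refine (norm_sum_le _ _).trans (Finset.sum_le_sum fun j _ => ?_)
  rw [PiLp.norm_single, Finset.sum_mul]
  simp only [toLpLin_apply, mulVec, dotProduct, transpose_apply]
  refine (norm_sum_le _ _).trans (Finset.sum_le_sum fun i _ => ?_)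
  rw [norm_mul, Real.norm_eq_abs]
  exact mul_le_mul_of_nonneg_left (PiLp.norm_apply_le x i) (abs_nonneg _)

/-- The sketches with entry sum at most `N` that see the direction `v` by at least `1 / (N + 1)`. -/
def seeing (v : PD n m) (N : ℕ) : Set (Sketch n m) :=
  {s | entrySum s ≤ N ∧ 1 / ((N : ℝ) + 1) ≤ ‖toEuclideanLin s.2ᵀ v‖}

theorem measurableSet_seeing (v : PD n m) (N : ℕ) : MeasurableSet (seeing v N) :=
  (measurableSet_le measurable_entrySum measurable_const).inter
    (measurableSet_le measurable_const (measurable_norm_transpose_apply v))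

theorem exists_measure_seeing_ne_zero (μ : Measure (Sketch n m)) (v : PD n m)
    (hv : μ {s | s.2.transpose.mulVec v.ofLp ≠ 0} ≠ 0) : ∃ N, μ (seeing v N) ≠ 0 := by
  by_contra! h
  refine hv (measure_mono_null ?_ (measure_iUnion_null h))
  intro s hs
  have hpos : 0 < ‖toEuclideanLin s.2ᵀ v‖ := by
    rw [norm_pos_iff]
    intro h0
    apply hs
    simpa [toLpLin_apply] using congrArg WithLp.ofLp h0
  obtain ⟨a, ha⟩ := exists_nat_ge (entrySum s)
  obtain ⟨b, hb⟩ := exists_nat_one_div_lt hpos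
  refine Set.mem_iUnion.mpr ⟨max a b, ha.trans (by exact_mod_cast le_max_left a b), ?_⟩
  refine le_trans ?_ hb.le
  apply one_div_le_one_div_of_le (by positivity)
  have : (b : ℝ) ≤ (max a b : ℕ) := by exact_mod_cast le_max_right a b
  linarith

theorem exists_finite_seeing_family (μ : Measure (Sketch n m))
    (hμ : ∀ v : PD n m, v ≠ 0 → μ {s | s.2.transpose.mulVec v.ofLp ≠ 0} ≠ 0) :
    ∃ (M : ℕ) (E : Fin M → Set (Sketch n m)) (K κ : ℝ), 0 ≤ K ∧ 0 < κ ∧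
      (∀ i, MeasurableSet (E i) ∧ μ (E i) ≠ 0) ∧
      ∀ v : PD n m, v ≠ 0 → ∃ i, ∀ s ∈ E i,
        (∀ x : PD n m, ‖toEuclideanLin s.2ᵀ x‖ ≤ K * ‖x‖) ∧
          κ * ‖v‖ ≤ ‖toEuclideanLin s.2ᵀ v‖ := by
  have hex : ∀ v : PD n m, ∃ N, v ≠ 0 → μ (seeing v N) ≠ 0 := by
    intro v
    by_cases hv : v = 0
    · exact ⟨0, fun h => absurd hv h⟩
    · obtain ⟨N, hN⟩ := exists_measure_seeing_ne_zero μ v (hμ v hv)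
      exact ⟨N, fun _ => hN⟩
  choose N hN using hex
  obtain ⟨t, ht, hcov⟩ := (isCompact_sphere (0 : PD n m) 1).elim_nhds_subcover
    (fun v => Metric.ball v (1 / (2 * ((N v : ℝ) + 1) ^ 2)))
    (fun v _ => Metric.ball_mem_nhds v (by positivity))
  have hne : ∀ v ∈ t, v ≠ 0 := fun v hv => by
    have := ht v hv
    rintro rfl
    simp at this
  refine ⟨t.card, fun i => seeing (t.equivFin.symm i : PD n m) (N (t.equivFin.symm i)),
    (t.sup N : ℕ), 1 / (2 * ((t.sup N : ℕ) + 1)), by positivity, by positivity,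
    fun i => ⟨measurableSet_seeing _ _, hN _ (hne _ (t.equivFin.symm i).2)⟩, fun v hv => ?_⟩
  have hvn : 0 < ‖v‖ := norm_pos_iff.mpr hv
  have hmem : ‖v‖⁻¹ • v ∈ Metric.sphere (0 : PD n m) 1 := by
    simp [norm_smul, hvn.ne']
  obtain ⟨w, hw, hwb⟩ := Set.mem_iUnion₂.mp (hcov hmem)
  refine ⟨t.equivFin ⟨w, hw⟩, fun s hs => ?_⟩
  simp only [Equiv.symm_apply_apply] at hs
  have hNle : (N w : ℝ) ≤ (t.sup N : ℕ) := by exact_mod_cast Finset.le_sup hw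
  have hs1 : entrySum s ≤ N w := hs.1
  refine ⟨fun x => (norm_transpose_apply_le s x).trans
    (mul_le_mul_of_nonneg_right (hs1.trans hNle) (norm_nonneg _)), ?_⟩
  rw [Metric.mem_ball, dist_eq_norm] at hwb
  have h1 : ‖toEuclideanLin s.2ᵀ w‖ ≤ ‖toEuclideanLin s.2ᵀ (‖v‖⁻¹ • v)‖
      + ‖toEuclideanLin s.2ᵀ (‖v‖⁻¹ • v - w)‖ := by
    rw [map_sub (toEuclideanLin s.2ᵀ) (‖v‖⁻¹ • v) w, norm_sub_rev]
    exact norm_le_insert' _ _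
  have h2 : ‖toEuclideanLin s.2ᵀ (‖v‖⁻¹ • v - w)‖ ≤ 1 / (2 * ((N w : ℝ) + 1)) := by
    refine (norm_transpose_apply_le s _).trans ?_
    calc entrySum s * ‖‖v‖⁻¹ • v - w‖ ≤ ((N w : ℝ) + 1) * (1 / (2 * ((N w : ℝ) + 1) ^ 2)) :=
          mul_le_mul (by linarith) hwb.le (norm_nonneg _) (by positivity)
      _ = _ := by field_simp
  have h3 : 1 / (2 * ((N w : ℝ) + 1)) ≤ ‖toEuclideanLin s.2ᵀ (‖v‖⁻¹ • v)‖ := by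
    have h4 : 1 / ((N w : ℝ) + 1) = 1 / (2 * ((N w : ℝ) + 1)) + 1 / (2 * ((N w : ℝ) + 1)) := by
      field_simp; norm_num
    have := hs.2
    linarith
  have h5 : 1 / (2 * (((t.sup N : ℕ) : ℝ) + 1)) ≤ 1 / (2 * ((N w : ℝ) + 1)) :=
    one_div_le_one_div_of_le (by positivity) (by linarith)
  have h6 := h5.trans h3
  rw [map_smul, norm_smul, norm_inv, norm_norm] at h6
  calc _ ≤ ‖v‖⁻¹ * ‖toEuclideanLin s.2ᵀ v‖ * ‖v‖ := mul_le_mul_of_nonneg_right h6 hvn.le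
    _ = _ := by field_simp

end Sketches

/-- For independent identically distributed variables, a finite pattern of events of positive
probability occurs in arbitrarily late consecutive windows. -/
theorem ae_frequently_window {Ω α : Type*} [MeasurableSpace Ω] [MeasurableSpace α]
    (P : Measure Ω) [IsProbabilityMeasure P] (S : ℕ → Ω → α) (μ : Measure α)
    (hS : ∀ j, Measurable (S j)) (hlaw : ∀ j, P.map (S j) = μ) (hind : iIndepFun S P)
    {M : ℕ} (E : Fin M → Set α) (hE : ∀ i, MeasurableSet (E i) ∧ μ (E i) ≠ 0) :
    ∀ᵐ ω ∂P, ∀ Q, ∃ q ≥ Q, ∀ i : Fin M, S (q + i) ω ∈ E i := by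
  set W : ℕ → Set Ω := fun q => ⋂ i : Fin M, S (q * M + i) ⁻¹' E i with hW
  have hpre : ∀ q, ∀ i : Fin M, MeasurableSet (S (q * M + i) ⁻¹' E i) :=
    fun q i => hS _ (hE i).1
  have hWm : ∀ q, MeasurableSet (W q) := fun q => MeasurableSet.iInter fun i => hpre q i
  have hinj : Function.Injective fun x : ℕ × Fin M => x.1 * M + (x.2 : ℕ) := by
    rintro ⟨a, i⟩ ⟨b, j⟩ h
    simp only at h
    have hM : 0 < M := i.pos
    have ha : (a * M + i) / M = a := by
      rw [mul_comm, Nat.mul_add_div hM, Nat.div_eq_of_lt i.2, add_zero]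
    have hb : (b * M + j) / M = b := by
      rw [mul_comm, Nat.mul_add_div hM, Nat.div_eq_of_lt j.2, add_zero]
    have hab : a = b := by rw [← ha, h, hb]
    subst hab
    exact Prod.ext rfl (Fin.ext (Nat.add_left_cancel h))
  have hind' := hind.precomp hinj
  have hprob : ∀ s : Finset ℕ, P (⋂ q ∈ s, W q) = ∏ q ∈ s, ∏ i, μ (E i) := by
    intro s
    have h := (iIndepFun_iff_measure_inter_preimage_eq_mul.mp hind') (s ×ˢ Finset.univ)
      (sets := fun x => E x.2) (fun x _ => (hE x.2).1)
    have hset : (⋂ q ∈ s, W q) = ⋂ x ∈ s ×ˢ (Finset.univ : Finset (Fin M)),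
        S (x.1 * M + (x.2 : ℕ)) ⁻¹' E x.2 := by
      ext ω
      simp only [hW, Set.mem_iInter, Finset.mem_product, Finset.mem_univ, and_true, Prod.forall]
      exact ⟨fun h a b ha => h a ha b, fun h a ha b => h a b ha⟩
    rw [hset]
    refine h.trans ?_
    rw [Finset.prod_product]
    refine Finset.prod_congr rfl fun q _ => Finset.prod_congr rfl fun i _ => ?_
    rw [← hlaw (q * M + i), Measure.map_apply (hS _) (hE i).1]
  have hW1 : ∀ q, P (W q) = ∏ i, μ (E i) := fun q => by simpa using hprob {q}
  have hWind : iIndepSet W P := by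
    rw [iIndepSet_iff_meas_biInter hWm]
    intro s
    rw [hprob]
    exact Finset.prod_congr rfl fun q _ => (hW1 q).symm
  have hsum : ∑' q, P (W q) = ⊤ := by
    simp only [hW1]
    exact ENNReal.tsum_const_eq_top_of_ne_zero (Finset.prod_ne_zero_iff.mpr fun i _ => (hE i).2)
  have hlim := measure_limsup_eq_one hWm hWind hsum
  have hae : ∀ᵐ ω ∂P, ω ∈ Filter.limsup W Filter.atTop := by
    rw [← prob_compl_eq_zero_iff (MeasurableSet.measurableSet_limsup hWm)] at hlim
    exact hlim
  filter_upwards [hae] with ω hω Q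
  rw [Filter.mem_limsup_iff_frequently_mem, Filter.frequently_atTop] at hω
  obtain ⟨q, hq, hmem⟩ := hω Q
  rcases Nat.eq_zero_or_pos M with rfl | hM
  · exact ⟨Q, le_rfl, fun i => i.elim0⟩
  · exact ⟨q * M, hq.trans (Nat.le_mul_of_pos_right q hM), fun i => Set.mem_iInter.mp hmem i⟩

theorem ae_recurrent {n m : ℕ} {Ω : Type*} [MeasurableSpace Ω] (P : Measure Ω)
    [IsProbabilityMeasure P] (S : ℕ → Ω → Sketch n m) (μ : Measure (Sketch n m))
    (hS : ∀ j, Measurable (S j)) (hlaw : ∀ j, P.map (S j) = μ) (hind : iIndepFun S P)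
    (hμ : ∀ v : PD n m, v ≠ 0 → μ {s | s.2.transpose.mulVec v.ofLp ≠ 0} ≠ 0) :
    ∀ᵐ ω ∂P, Recurrent fun j => S j ω := by
  obtain ⟨M, E, K, κ, hK, hκ, hE, hsee⟩ := exists_finite_seeing_family μ hμ
  filter_upwards [ae_frequently_window P S μ hS hlaw hind E hE] with ω hω
  refine ⟨M, K, κ, hK, hκ, fun Q => ?_⟩
  obtain ⟨q, hq, h⟩ := hω Q
  refine ⟨q, hq, fun v hv => ?_⟩
  obtain ⟨i, hi⟩ := hsee v hv
  exact ⟨i, i.2, hi _ (h i)⟩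

end Probability

/-! ## Uniform estimates for KKT systems -/

section KKT

variable {E F : Type*} [NormedAddCommGroup E] [InnerProductSpace ℝ E]
  [NormedAddCommGroup F] [InnerProductSpace ℝ F]

/-- The blocks `A`, `G`, `Gt = Gᵀ` of a KKT matrix with uniform regularity constants. -/
structure RegularKKT (A : E →ₗ[ℝ] E) (G : E →ₗ[ℝ] F) (Gt : F →ₗ[ℝ] E) (s ξ b : ℝ) : Prop where
  adjoint : ∀ x y, inner ℝ (G x) y = inner ℝ x (Gt y)
  lower : ∀ y, s * ‖y‖ ≤ ‖Gt y‖
  coercive : ∀ x, G x = 0 → ξ * ‖x‖ ^ 2 ≤ inner ℝ x (A x)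
  bound : ∀ x, ‖A x‖ ≤ b * ‖x‖

variable {A : E →ₗ[ℝ] E} {G : E →ₗ[ℝ] F} {Gt : F →ₗ[ℝ] E} {s ξ b : ℝ}

theorem RegularKKT.exists_decomposition [FiniteDimensional ℝ F] (h : RegularKKT A G Gt s ξ b)
    (hs : 0 < s) (x : E) :
    ∃ v t, x = v + t ∧ G v = 0 ∧ s * ‖t‖ ≤ ‖G x‖ := by
  have hsq : ∀ y, ‖Gt y‖ ^ 2 = inner ℝ (G (Gt y)) y := fun y => by
    rw [h.adjoint, real_inner_self_eq_norm_sq]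
  have hinj : Function.Injective (G ∘ₗ Gt) := by
    rw [← LinearMap.ker_eq_bot, LinearMap.ker_eq_bot']
    intro y hy
    have h1 : ‖Gt y‖ ^ 2 = 0 := by
      rw [hsq, show G (Gt y) = 0 from hy, inner_zero_left]
    have h2 := h.lower y
    rw [pow_eq_zero_iff two_ne_zero] at h1
    rw [h1] at h2
    exact norm_eq_zero.mp (le_antisymm (by nlinarith [norm_nonneg y]) (norm_nonneg y))
  obtain ⟨y, hy⟩ := (LinearMap.injective_iff_surjective.mp hinj) (G x)
  have hy' : G (Gt y) = G x := hy
  refine ⟨x - Gt y, Gt y, by abel, by rw [map_sub, hy', sub_self], ?_⟩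
  have h1 : ‖Gt y‖ ^ 2 ≤ ‖G x‖ * ‖y‖ := by
    rw [hsq, hy']; exact real_inner_le_norm _ _
  have h2 := h.lower y
  rcases (norm_nonneg (Gt y)).eq_or_lt with h0 | h0
  · rw [← h0, mul_zero]; exact norm_nonneg _
  · have h3 : s * ‖Gt y‖ * ‖Gt y‖ ≤ ‖G x‖ * ‖Gt y‖ := by
      nlinarith [mul_le_mul_of_nonneg_left h2 (norm_nonneg (G x)),
        mul_le_mul_of_nonneg_left h1 hs.le]
    exact le_of_mul_le_mul_right h3 h0

/-- The inverses of regular KKT matrices are uniformly bounded. -/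
theorem exists_kkt_inverse_bound (E F : Type*) [NormedAddCommGroup E] [InnerProductSpace ℝ E]
    [NormedAddCommGroup F] [InnerProductSpace ℝ F] [FiniteDimensional ℝ F]
    {s ξ b : ℝ} (hs : 0 < s) (hξ : 0 < ξ) (hb : 0 ≤ b) :
    ∃ C > 0, ∀ (A : E →ₗ[ℝ] E) (G : E →ₗ[ℝ] F) (Gt : F →ₗ[ℝ] E), RegularKKT A G Gt s ξ b →
      ∀ x l, ‖x‖ + ‖l‖ ≤ C * (‖A x + Gt l‖ + ‖G x‖) := by
  set C1 : ℝ := (1 + b / s) / ξ + 1 / s with hC1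
  have hC1pos : 0 < C1 := by positivity
  refine ⟨C1 + (1 + b * C1) / s, by positivity, fun A G Gt h x l => ?_⟩
  obtain ⟨v, t, hx, hv, ht⟩ := h.exists_decomposition hs x
  set a := ‖A x + Gt l‖ with ha
  set d := ‖G x‖ with hd
  have ha0 : 0 ≤ a := norm_nonneg _
  have hd0 : 0 ≤ d := norm_nonneg _
  have ht' : ‖t‖ ≤ d / s := by rw [le_div_iff₀ hs]; linarith
  have hvA : inner ℝ v (A v) = inner ℝ v (A x + Gt l) - inner ℝ v (A t) := by
    have h1 : inner ℝ v (Gt l) = 0 := by rw [← h.adjoint, hv, inner_zero_left]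
    rw [inner_add_right, h1, hx, map_add, inner_add_right]; ring
  have h1 : ξ * ‖v‖ ^ 2 ≤ ‖v‖ * (a + b * (d / s)) := by
    have e1 := real_inner_le_norm v (A x + Gt l)
    have e2 := neg_le_of_abs_le (abs_real_inner_le_norm v (A t))
    have e3 : ‖A t‖ ≤ b * (d / s) := (h.bound t).trans (mul_le_mul_of_nonneg_left ht' hb)
    have e4 := mul_le_mul_of_nonneg_left e3 (norm_nonneg v)
    have e5 := h.coercive v hv
    rw [mul_add]; linarith
  have hv' : ‖v‖ ≤ (a + b * (d / s)) / ξ := by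
    rw [le_div_iff₀ hξ]
    rcases (norm_nonneg v).eq_or_lt with h0 | h0
    · rw [← h0, zero_mul]; positivity
    · exact le_of_mul_le_mul_left (by linarith) h0
  have hxn : ‖x‖ ≤ C1 * (a + d) := by
    have e1 : ‖x‖ ≤ ‖v‖ + ‖t‖ := by rw [hx]; exact norm_add_le _ _
    have e2 : (a + b * (d / s)) / ξ + d / s ≤ C1 * (a + d) := by
      have : C1 * (a + d) = (a + b * (d / s)) / ξ + d / s + ((d + b / s * a) / ξ + a / s) := by
        rw [hC1]; field_simp; ring
      rw [this]
      have : 0 ≤ (d + b / s * a) / ξ + a / s := by positivity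
      linarith
    linarith
  have hln : ‖l‖ ≤ (1 + b * C1) / s * (a + d) := by
    have e1 : ‖Gt l‖ ≤ a + b * ‖x‖ := by
      have : Gt l = (A x + Gt l) - A x := by abel
      rw [this]
      exact (norm_sub_le _ _).trans (by linarith [h.bound x])
    have e2 := h.lower l
    rw [div_mul_eq_mul_div, le_div_iff₀ hs]
    nlinarith [mul_le_mul_of_nonneg_left hxn hb]
  linarith

theorem descent_scalar {ξ C a h c η₁ η₂ : ℝ} (hξ : 0 < ξ) (hC : 0 < C)
    (hη₂ : 0 < η₂) (h1 : η₂ ≤ 1) (h2 : 8 * C ^ 2 * η₂ ≤ ξ)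
    (hη₁ : C ^ 2 / (2 * ξ) + C + 9 * C ^ 2 + 1 ≤ η₁ * η₂) :
    -ξ * a ^ 2 + C * (a * c) + C * c ^ 2 + C * (c * h) + η₂ * (C * (h * a)) + η₂ * (C * (h * c))
      - η₁ * c ^ 2 - η₂ * h ^ 2 ≤ -(3 / 4 * η₂ * (h ^ 2 + c ^ 2)) := by
  have e1 : C * (a * c) ≤ ξ / 2 * a ^ 2 + C ^ 2 / (2 * ξ) * c ^ 2 := by
    have : 0 ≤ (ξ * a - C * c) ^ 2 / (2 * ξ) := by positivity
    have e : (ξ * a - C * c) ^ 2 / (2 * ξ)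
        = ξ / 2 * a ^ 2 + C ^ 2 / (2 * ξ) * c ^ 2 - C * (a * c) := by field_simp; ring
    linarith
  have e2 : C * (c * h) ≤ η₂ / 16 * h ^ 2 + 4 * C ^ 2 / η₂ * c ^ 2 := by
    have : 0 ≤ (η₂ * h - 8 * C * c) ^ 2 / (16 * η₂) := by positivity
    have e : (η₂ * h - 8 * C * c) ^ 2 / (16 * η₂)
        = η₂ / 16 * h ^ 2 + 4 * C ^ 2 / η₂ * c ^ 2 - C * (c * h) := by field_simp; ring
    linarith
  have e3 : η₂ * (C * (h * a)) ≤ η₂ / 16 * h ^ 2 + ξ / 2 * a ^ 2 := by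
    have k1 : C * (h * a) ≤ h ^ 2 / 16 + 4 * C ^ 2 * a ^ 2 := by
      nlinarith [sq_nonneg (h - 8 * C * a)]
    have k2 := mul_le_mul_of_nonneg_left k1 hη₂.le
    have k3 := mul_le_mul_of_nonneg_right h2 (sq_nonneg a)
    linarith
  have e4 : η₂ * (C * (h * c)) ≤ η₂ / 16 * h ^ 2 + 4 * C ^ 2 / η₂ * c ^ 2 := by
    have k1 : C * (h * c) ≤ h ^ 2 / 16 + 4 * C ^ 2 * c ^ 2 := by
      nlinarith [sq_nonneg (h - 8 * C * c)]
    have k2 := mul_le_mul_of_nonneg_left k1 hη₂.le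
    have k3 : η₂ * (4 * C ^ 2 * c ^ 2) ≤ 4 * C ^ 2 / η₂ * c ^ 2 := by
      rw [div_mul_eq_mul_div, le_div_iff₀ hη₂]
      have : η₂ * η₂ ≤ 1 := by nlinarith
      nlinarith [mul_le_mul_of_nonneg_right this (by positivity : 0 ≤ 4 * C ^ 2 * c ^ 2)]
    linarith
  have e5 : (C ^ 2 / (2 * ξ) + C + 8 * C ^ 2 / η₂ + 3 / 4 * η₂) * c ^ 2 ≤ η₁ * c ^ 2 := by
    refine mul_le_mul_of_nonneg_right ?_ (sq_nonneg c)
    have k : (C ^ 2 / (2 * ξ) + C + 8 * C ^ 2 / η₂ + 3 / 4 * η₂) * η₂ ≤ η₁ * η₂ := by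
      have k1 : 8 * C ^ 2 / η₂ * η₂ = 8 * C ^ 2 := by field_simp
      have k2 : 0 ≤ C ^ 2 / (2 * ξ) := by positivity
      nlinarith [mul_le_mul_of_nonneg_left h1 k2, mul_le_mul_of_nonneg_left h1 hC.le,
        sq_nonneg C]
    exact le_of_mul_le_mul_right k hη₂
  have e6 : 8 * C ^ 2 / η₂ * c ^ 2 = 4 * C ^ 2 / η₂ * c ^ 2 + 4 * C ^ 2 / η₂ * c ^ 2 := by ring
  nlinarith [mul_nonneg hη₂.le (sq_nonneg h)]

/-- For a small `η₂` and a large product `η₁ η₂`, exact Newton directions are uniformly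
descent directions of the augmented Lagrangian. -/
theorem exists_exact_descent (E F : Type*) [NormedAddCommGroup E] [InnerProductSpace ℝ E]
    [NormedAddCommGroup F] [InnerProductSpace ℝ F] [FiniteDimensional ℝ F]
    {s ξ b γ : ℝ} (hs : 0 < s) (hξ : 0 < ξ) (hb : 0 ≤ b) (hγ : 0 ≤ γ) :
    ∃ e > 0, ∃ C, ∀ (A : E →ₗ[ℝ] E) (G : E →ₗ[ℝ] F) (Gt : F →ₗ[ℝ] E), RegularKKT A G Gt s ξ b →
      ∀ T : E →ₗ[ℝ] E, (∀ x, ‖T x‖ ≤ γ * ‖x‖) → ∀ (x g : E) (l c : F) (η₁ η₂ : ℝ),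
        0 < η₂ → η₂ ≤ e → C ≤ η₁ * η₂ → A x + Gt l = -g → G x = -c →
        inner ℝ g x + inner ℝ c l + η₁ * inner ℝ c (G x) + η₂ * inner ℝ g (T x + Gt l)
          ≤ -(3 / 4 * η₂ * (‖g‖ ^ 2 + ‖c‖ ^ 2)) := by
  set q : ℝ := s⁻¹ with hq
  have hq0 : 0 < q := inv_pos.mpr hs
  set C : ℝ := 1 + 4 * b * q + 3 * b * q ^ 2 + 2 * q + (b + γ) * (1 + q) with hC
  have hCpos : 0 < C := by positivity
  refine ⟨min 1 (ξ / (8 * C ^ 2)), by positivity, C ^ 2 / (2 * ξ) + C + 9 * C ^ 2 + 1, ?_⟩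
  intro A G Gt h T hT x g l c η₁ η₂ hη₂ hle hη₁ hA hG
  obtain ⟨v, t, hx, hv, ht⟩ := h.exists_decomposition hs x
  rw [hG, norm_neg] at ht
  have hη1 : η₂ ≤ 1 := hle.trans (min_le_left _ _)
  have hη2 : 8 * C ^ 2 * η₂ ≤ ξ := by
    have := hle.trans (min_le_right _ _)
    rw [le_div_iff₀ (by positivity)] at this
    linarith
  refine le_trans ?_ (descent_scalar (a := ‖v‖) (h := ‖g‖) (c := ‖c‖) hξ hCpos hη₂ hη1 hη2 hη₁)
  have hg : g = -(A x + Gt l) := by rw [hA, neg_neg]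
  have hcl : inner ℝ (G x) l = -inner ℝ c l := by rw [hG, inner_neg_left]
  have k1 : inner ℝ g x = -inner ℝ x (A x) + inner ℝ c l := by
    rw [real_inner_comm, hg, inner_neg_right, inner_add_right, ← h.adjoint, hcl]; ring
  have k2 : inner ℝ c (G x) = -‖c‖ ^ 2 := by
    rw [hG, inner_neg_right, real_inner_self_eq_norm_sq]
  have k3 : T x + Gt l = (T x - A x) - g := by rw [hg]; abel
  have k4 : inner ℝ g (T x + Gt l) = inner ℝ g (T x - A x) - ‖g‖ ^ 2 := by
    rw [k3, inner_sub_right, real_inner_self_eq_norm_sq]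
  rw [k4, k1, k2]
  have nv := norm_nonneg v
  have nt := norm_nonneg t
  have nc := norm_nonneg c
  have ng := norm_nonneg g
  have nl := norm_nonneg l
  have ht' : ‖t‖ ≤ q * ‖c‖ := by
    rw [hq, inv_mul_eq_div, le_div_iff₀ hs]; linarith
  have hxn : ‖x‖ ≤ ‖v‖ + q * ‖c‖ := by
    rw [hx]; exact (norm_add_le _ _).trans (by linarith)
  have hl : ‖l‖ ≤ q * (‖g‖ + b * (‖v‖ + q * ‖c‖)) := by
    have e1 : ‖Gt l‖ ≤ ‖g‖ + b * (‖v‖ + q * ‖c‖) := by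
      have : Gt l = -g - A x := by rw [← hA]; abel
      rw [this]
      refine (norm_sub_le _ _).trans ?_
      rw [norm_neg]
      linarith [h.bound x, mul_le_mul_of_nonneg_left hxn hb]
    have e2 := h.lower l
    rw [hq, inv_mul_eq_div, le_div_iff₀ hs]
    linarith
  have hclb : inner ℝ c l ≤ ‖c‖ * (q * (‖g‖ + b * (‖v‖ + q * ‖c‖))) :=
    (real_inner_le_norm _ _).trans (mul_le_mul_of_nonneg_left hl nc)
  have hxA : ξ * ‖v‖ ^ 2 - 2 * b * (‖v‖ * (q * ‖c‖)) - b * (q * ‖c‖) ^ 2 ≤ inner ℝ x (A x) := by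
    have e0 : inner ℝ x (A x)
        = inner ℝ v (A v) + inner ℝ v (A t) + inner ℝ t (A v) + inner ℝ t (A t) := by
      rw [hx, map_add, inner_add_left, inner_add_right, inner_add_right]; ring
    have ip : ∀ y z : E, -(b * (‖y‖ * ‖z‖)) ≤ inner ℝ y (A z) := fun y z => by
      have := neg_le_of_abs_le (abs_real_inner_le_norm y (A z))
      have := mul_le_mul_of_nonneg_left (h.bound z) (norm_nonneg y)
      nlinarith
    have e1 := ip v t
    have e2 := ip t v
    have e3 := ip t t
    have e4 := h.coercive v hv
    have e5 : b * (‖v‖ * ‖t‖) ≤ b * (‖v‖ * (q * ‖c‖)) := by gcongr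
    have e6 : b * (‖t‖ * ‖t‖) ≤ b * (q * ‖c‖) ^ 2 := by rw [sq]; gcongr
    rw [e0]
    linarith [mul_comm ‖t‖ ‖v‖]
  have hgT : inner ℝ g (T x - A x) ≤ ‖g‖ * ((b + γ) * (‖v‖ + q * ‖c‖)) := by
    refine (real_inner_le_norm _ _).trans (mul_le_mul_of_nonneg_left ?_ ng)
    calc ‖T x - A x‖ ≤ (b + γ) * ‖x‖ := (norm_sub_le _ _).trans (by linarith [h.bound x, hT x])
      _ ≤ _ := by gcongr
  have hgT' := mul_le_mul_of_nonneg_left hgT hη₂.le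
  have c1 : 4 * b * q * (‖v‖ * ‖c‖) ≤ C * (‖v‖ * ‖c‖) := by
    refine mul_le_mul_of_nonneg_right ?_ (by positivity)
    have : 0 ≤ 1 + 3 * b * q ^ 2 + 2 * q + (b + γ) * (1 + q) := by positivity
    linarith
  have c2 : 3 * b * q ^ 2 * ‖c‖ ^ 2 ≤ C * ‖c‖ ^ 2 := by
    refine mul_le_mul_of_nonneg_right ?_ (by positivity)
    have : 0 ≤ 1 + 4 * b * q + 2 * q + (b + γ) * (1 + q) := by positivity
    linarith
  have c3 : 2 * q * (‖c‖ * ‖g‖) ≤ C * (‖c‖ * ‖g‖) := by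
    refine mul_le_mul_of_nonneg_right ?_ (by positivity)
    have : 0 ≤ 1 + 4 * b * q + 3 * b * q ^ 2 + (b + γ) * (1 + q) := by positivity
    linarith
  have c4 : (b + γ) * (‖g‖ * ‖v‖) ≤ C * (‖g‖ * ‖v‖) := by
    refine mul_le_mul_of_nonneg_right ?_ (by positivity)
    have : 0 ≤ 1 + 4 * b * q + 3 * b * q ^ 2 + 2 * q + (b + γ) * q := by positivity
    linarith
  have c5 : (b + γ) * q * (‖g‖ * ‖c‖) ≤ C * (‖g‖ * ‖c‖) := by
    refine mul_le_mul_of_nonneg_right ?_ (by positivity)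
    have : 0 ≤ 1 + 4 * b * q + 3 * b * q ^ 2 + 2 * q + (b + γ) := by positivity
    linarith
  have d4 := mul_le_mul_of_nonneg_left c4 hη₂.le
  have d5 := mul_le_mul_of_nonneg_left c5 hη₂.le
  linarith

end KKT

/-! ## Derivatives of the Lagrangian and of the augmented Lagrangian -/

section PrimalDual

variable {n m : ℕ}

/-- `primal` as a continuous linear map. -/
def primalL : PD n m →L[ℝ] EuclideanSpace ℝ (Fin n) :=
  LinearMap.toContinuousLinearMap
    { toFun := primal, map_add' := fun _ _ => rfl, map_smul' := fun _ _ => rfl }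

/-- `dual` as a continuous linear map. -/
def dualL : PD n m →L[ℝ] EuclideanSpace ℝ (Fin m) :=
  LinearMap.toContinuousLinearMap
    { toFun := dual, map_add' := fun _ _ => rfl, map_smul' := fun _ _ => rfl }

/-- The pair `(x, l)`. -/
def pair (x : EuclideanSpace ℝ (Fin n)) (l : EuclideanSpace ℝ (Fin m)) : PD n m :=
  WithLp.toLp 2 (Sum.elim x l)

@[simp] theorem primalL_apply (z : PD n m) : primalL z = primal z := rfl

@[simp] theorem dualL_apply (z : PD n m) : dualL z = dual z := rfl

@[simp] theorem primal_pair (x : EuclideanSpace ℝ (Fin n)) (l : EuclideanSpace ℝ (Fin m)) :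
    primal (pair x l) = x := rfl

@[simp] theorem dual_pair (x : EuclideanSpace ℝ (Fin n)) (l : EuclideanSpace ℝ (Fin m)) :
    dual (pair x l) = l := rfl

@[simp] theorem pair_primal_dual (z : PD n m) : pair (primal z) (dual z) = z := by
  ext i
  cases i <;> rfl

theorem pair_eq_add (x : EuclideanSpace ℝ (Fin n)) (l : EuclideanSpace ℝ (Fin m)) :
    pair x l = pair x 0 + pair 0 l := by
  ext i
  cases i <;> simp [pair]

theorem inner_eq_primal_add_dual (z w : PD n m) :
    inner ℝ z w = inner ℝ (primal z) (primal w) + inner ℝ (dual z) (dual w) := by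
  simp [PiLp.inner_apply, primal, dual]

theorem norm_sq_eq_primal_add_dual (z : PD n m) :
    ‖z‖ ^ 2 = ‖primal z‖ ^ 2 + ‖dual z‖ ^ 2 := by
  simp only [← real_inner_self_eq_norm_sq, inner_eq_primal_add_dual]

theorem norm_primal_le (z : PD n m) : ‖primal z‖ ≤ ‖z‖ := by
  refine le_of_pow_le_pow_left₀ two_ne_zero (norm_nonneg _) ?_
  rw [norm_sq_eq_primal_add_dual]
  linarith [sq_nonneg ‖dual z‖]

theorem norm_dual_le (z : PD n m) : ‖dual z‖ ≤ ‖z‖ := by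
  refine le_of_pow_le_pow_left₀ two_ne_zero (norm_nonneg _) ?_
  rw [norm_sq_eq_primal_add_dual]
  linarith [sq_nonneg ‖primal z‖]

theorem norm_le_primal_add_dual (z : PD n m) : ‖z‖ ≤ ‖primal z‖ + ‖dual z‖ := by
  refine le_of_pow_le_pow_left₀ two_ne_zero (by positivity) ?_
  rw [norm_sq_eq_primal_add_dual]
  nlinarith [mul_nonneg (norm_nonneg (primal z)) (norm_nonneg (dual z))]

theorem norm_pair_zero (x : EuclideanSpace ℝ (Fin n)) :
    ‖pair x (0 : EuclideanSpace ℝ (Fin m))‖ ≤ ‖x‖ := by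
  simpa using norm_le_primal_add_dual (pair x (0 : EuclideanSpace ℝ (Fin m)))

theorem primal_kktMatrix_apply (B : Matrix (Fin n) (Fin n) ℝ) (G : Matrix (Fin m) (Fin n) ℝ)
    (u : PD n m) :
    primal (toEuclideanLin (kktMatrix B G) u)
      = toEuclideanLin B (primal u) + toEuclideanLin Gᵀ (dual u) := by
  ext i
  simp [primal, dual, kktMatrix, toLpLin_apply, mulVec, dotProduct]

theorem dual_kktMatrix_apply (B : Matrix (Fin n) (Fin n) ℝ) (G : Matrix (Fin m) (Fin n) ℝ)
    (u : PD n m) :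
    dual (toEuclideanLin (kktMatrix B G) u) = toEuclideanLin G (primal u) := by
  ext i
  simp [primal, dual, kktMatrix, toLpLin_apply, mulVec, dotProduct]

theorem kktMatrix_isSymm {B : Matrix (Fin n) (Fin n) ℝ} (hB : B.IsSymm)
    (G : Matrix (Fin m) (Fin n) ℝ) : (kktMatrix B G).IsSymm := by
  simp [Matrix.IsSymm, kktMatrix, fromBlocks_transpose, hB.eq]

end PrimalDual

section Calculus

variable {n m : ℕ} {f : EuclideanSpace ℝ (Fin n) → ℝ}
  {c : EuclideanSpace ℝ (Fin n) → EuclideanSpace ℝ (Fin m)}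

theorem toEuclideanLin_jacobian (x v : EuclideanSpace ℝ (Fin n)) :
    toEuclideanLin (jacobian c x) v = fderiv ℝ c x v := by
  have hv : v = ∑ j, v j • EuclideanSpace.single j (1 : ℝ) := by
    ext i; simp [Finset.sum_apply, Pi.single_apply]
  conv_rhs => rw [hv]
  ext i
  simp [toLpLin_apply, mulVec, dotProduct, jacobian, Finset.sum_apply, mul_comm]

theorem inner_jacobian_transpose (x v : EuclideanSpace ℝ (Fin n)) (l : EuclideanSpace ℝ (Fin m)) :
    inner ℝ (toEuclideanLin (jacobian c x)ᵀ l) v = inner ℝ l (fderiv ℝ c x v) := by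
  rw [inner_toEuclideanLin_left, transpose_transpose, toEuclideanLin_jacobian]

theorem lagr_eq_inner (x : EuclideanSpace ℝ (Fin n)) (l : EuclideanSpace ℝ (Fin m)) :
    lagr f c x l = f x + inner ℝ l (c x) := by
  simp [lagr, PiLp.inner_apply, mul_comm]

theorem gradX_eq (hf : Differentiable ℝ f) (hc : Differentiable ℝ c) (z : PD n m) :
    gradX f c z = (InnerProductSpace.toDual ℝ (EuclideanSpace ℝ (Fin n))).symm
      (fderiv ℝ f (primal z) + (innerSL ℝ (dual z)).comp (fderiv ℝ c (primal z))) := by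
  rw [gradX, gradient]
  congr 1
  have h : HasFDerivAt (fun x => f x + innerSL ℝ (dual z) (c x))
      (fderiv ℝ f (primal z) + (innerSL ℝ (dual z)).comp (fderiv ℝ c (primal z))) (primal z) :=
    (hf _).hasFDerivAt.add ((innerSL ℝ (dual z)).hasFDerivAt.comp _ (hc _).hasFDerivAt)
  have e : (fun x => lagr f c x (dual z)) = fun x => f x + innerSL ℝ (dual z) (c x) := by
    funext x; rw [lagr_eq_inner]; rfl
  rw [e]
  exact h.fderiv

theorem inner_gradX (hf : Differentiable ℝ f) (hc : Differentiable ℝ c) (z : PD n m)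
    (v : EuclideanSpace ℝ (Fin n)) :
    inner ℝ (gradX f c z) v
      = fderiv ℝ f (primal z) v + inner ℝ (dual z) (fderiv ℝ c (primal z) v) := by
  rw [gradX_eq hf hc, InnerProductSpace.toDual_symm_apply]
  rfl

theorem contDiff_gradX (hf : ContDiff ℝ 2 f) (hc : ContDiff ℝ 2 c) :
    ContDiff ℝ 1 (gradX f c : PD n m → _) := by
  have e : (gradX f c : PD n m → _) = fun z =>
      (InnerProductSpace.toDual ℝ (EuclideanSpace ℝ (Fin n))).symm
        (fderiv ℝ f (primalL z) + (innerSL ℝ (dualL z)).comp (fderiv ℝ c (primalL z))) := by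
    funext z
    exact gradX_eq (hf.differentiable (by norm_num)) (hc.differentiable (by norm_num)) z
  rw [e]
  have h1 : ContDiff ℝ 1 (fderiv ℝ f) := hf.fderiv_right (by norm_num)
  have h2 : ContDiff ℝ 1 (fderiv ℝ c) := hc.fderiv_right (by norm_num)
  refine (LinearIsometryEquiv.contDiff _).comp ((h1.comp primalL.contDiff).add ?_)
  exact ((innerSL ℝ).contDiff.comp dualL.contDiff).clm_comp (h2.comp primalL.contDiff)

theorem hasFDerivAt_lagrangian (hf : Differentiable ℝ f) (hc : Differentiable ℝ c) (z : PD n m) :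
    HasFDerivAt (lagrangian f c)
      ((innerSL ℝ (gradX f c z)).comp primalL + (innerSL ℝ (c (primal z))).comp dualL) z := by
  have e : lagrangian f c = fun z : PD n m => f (primalL z) + inner ℝ (dualL z) (c (primalL z)) := by
    funext z; rw [lagrangian, lagr_eq_inner]; rfl
  have h1 : HasFDerivAt (fun z : PD n m => c (primalL z)) ((fderiv ℝ c (primal z)).comp primalL) z :=
    (hc _).hasFDerivAt.comp z primalL.hasFDerivAt
  have h2 : HasFDerivAt (fun z : PD n m => f (primalL z)) ((fderiv ℝ f (primal z)).comp primalL) z :=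
    (hf _).hasFDerivAt.comp z primalL.hasFDerivAt
  rw [e]
  refine (h2.add ((dualL.hasFDerivAt (x := z)).inner ℝ h1)).congr_fderiv ?_
  refine ContinuousLinearMap.ext fun u => ?_
  simp [inner_gradX hf hc, real_inner_comm]
  ring

theorem inner_gradL (hf : Differentiable ℝ f) (hc : Differentiable ℝ c) (z u : PD n m) :
    inner ℝ (gradL f c z) u = inner ℝ (gradX f c z) (primal u) + inner ℝ (c (primal z)) (dual u) := by
  rw [gradL, gradient, (hasFDerivAt_lagrangian hf hc z).fderiv,
    InnerProductSpace.toDual_symm_apply]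
  rfl

theorem gradL_eq_pair (hf : Differentiable ℝ f) (hc : Differentiable ℝ c) (z : PD n m) :
    gradL f c z = pair (gradX f c z) (c (primal z)) :=
  ext_inner_right ℝ fun u => by rw [inner_gradL hf hc, inner_eq_primal_add_dual]; rfl

/-- The second derivative of the Lagrangian in `x`, as the partial derivative of `gradX`. -/
def hessX (f : EuclideanSpace ℝ (Fin n) → ℝ)
    (c : EuclideanSpace ℝ (Fin n) → EuclideanSpace ℝ (Fin m)) (z : PD n m) :
    EuclideanSpace ℝ (Fin n) →ₗ[ℝ] EuclideanSpace ℝ (Fin n) where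
  toFun x := fderiv ℝ (gradX f c) z (pair x 0)
  map_add' x y := by
    rw [← map_add]; congr 1; ext i; cases i <;> simp [pair]
  map_smul' a x := by
    rw [← map_smul]; congr 1; ext i; cases i <;> simp [pair]

theorem norm_hessX_apply_le (z : PD n m) (x : EuclideanSpace ℝ (Fin n)) :
    ‖hessX f c z x‖ ≤ ‖fderiv ℝ (gradX f c) z‖ * ‖x‖ :=
  ((fderiv ℝ (gradX f c) z).le_opNorm _).trans
    (mul_le_mul_of_nonneg_left (norm_pair_zero x) (norm_nonneg _))

theorem fderiv_gradX_apply (hf : ContDiff ℝ 2 f) (hc : ContDiff ℝ 2 c) (z u : PD n m) :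
    fderiv ℝ (gradX f c) z u
      = hessX f c z (primal u) + toEuclideanLin (jacobian c (primal z))ᵀ (dual u) := by
  have hf1 : Differentiable ℝ f := hf.differentiable (by norm_num)
  have hc1 : Differentiable ℝ c := hc.differentiable (by norm_num)
  have hd : DifferentiableAt ℝ (gradX f c) z :=
    (contDiff_gradX hf hc).differentiable (by norm_num) z
  conv_lhs => rw [← pair_primal_dual u, pair_eq_add, map_add]
  congr 1
  set w : PD n m := pair 0 (dual u) with hw
  have h1 : HasDerivAt (fun t : ℝ => gradX f c (z + t • w)) (fderiv ℝ (gradX f c) z w) 0 := by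
    have hl : HasDerivAt (fun t : ℝ => z + t • w) w 0 := by
      simpa using ((hasDerivAt_id (0 : ℝ)).smul_const w).const_add z
    have hd' : HasFDerivAt (gradX f c) (fderiv ℝ (gradX f c) z) (z + (0 : ℝ) • w) := by
      simpa using hd.hasFDerivAt
    exact hd'.comp_hasDerivAt 0 hl
  have h2 : (fun t : ℝ => gradX f c (z + t • w)) = fun t : ℝ =>
      gradX f c z + t • toEuclideanLin (jacobian c (primal z))ᵀ (dual u) := by
    funext t
    refine ext_inner_right ℝ fun v => ?_
    have hp : primal (z + t • w) = primal z := by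
      rw [← primalL_apply, map_add, map_smul, primalL_apply, primalL_apply, hw, primal_pair,
        smul_zero, add_zero]
    have hq : dual (z + t • w) = dual z + t • dual u := by
      rw [← dualL_apply, map_add, map_smul, dualL_apply, dualL_apply, hw, dual_pair]
    rw [inner_gradX hf1 hc1, hp, hq, inner_add_left, inner_add_left, inner_gradX hf1 hc1,
      inner_smul_left, inner_smul_left, inner_jacobian_transpose]
    simp only [conj_trivial]
    ring
  rw [h2] at h1
  have h3 : HasDerivAt (fun t : ℝ =>
      gradX f c z + t • toEuclideanLin (jacobian c (primal z))ᵀ (dual u))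
      (toEuclideanLin (jacobian c (primal z))ᵀ (dual u)) 0 := by
    simpa using ((hasDerivAt_id (0 : ℝ)).smul_const
      (toEuclideanLin (jacobian c (primal z))ᵀ (dual u))).const_add (gradX f c z)
  exact h1.unique h3

theorem contDiff_merit (hf : ContDiff ℝ 2 f) (hc : ContDiff ℝ 2 c) (η₁ η₂ : ℝ) :
    ContDiff ℝ 1 (merit f c η₁ η₂ : PD n m → ℝ) := by
  have hf1 : ContDiff ℝ 1 f := hf.of_le (by norm_num)
  have hc1 : ContDiff ℝ 1 c := hc.of_le (by norm_num)
  have e : lagrangian f c = fun z : PD n m => f (primalL z) + inner ℝ (dualL z) (c (primalL z)) := by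
    funext z; rw [lagrangian, lagr_eq_inner]; rfl
  have hc2 : ContDiff ℝ 1 fun z : PD n m => c (primal z) := hc1.comp primalL.contDiff
  have h1 : ContDiff ℝ 1 (lagrangian f c : PD n m → ℝ) := by
    rw [e]
    exact (hf1.comp primalL.contDiff).add (dualL.contDiff.inner ℝ hc2)
  exact (h1.add (contDiff_const.mul (hc2.norm_sq ℝ))).add
    (contDiff_const.mul ((contDiff_gradX hf hc).norm_sq ℝ))

theorem inner_gradMerit_eq_fderiv (η₁ η₂ : ℝ) (z u : PD n m) :
    inner ℝ (gradMerit f c η₁ η₂ z) u = fderiv ℝ (merit f c η₁ η₂) z u := by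
  rw [gradMerit, gradient, InnerProductSpace.toDual_symm_apply]

theorem inner_gradMerit (hf : ContDiff ℝ 2 f) (hc : ContDiff ℝ 2 c) (η₁ η₂ : ℝ) (z u : PD n m) :
    inner ℝ (gradMerit f c η₁ η₂ z) u =
      inner ℝ (gradX f c z) (primal u) + inner ℝ (c (primal z)) (dual u)
      + η₁ * inner ℝ (c (primal z)) (toEuclideanLin (jacobian c (primal z)) (primal u))
      + η₂ * inner ℝ (gradX f c z)
        (hessX f c z (primal u) + toEuclideanLin (jacobian c (primal z))ᵀ (dual u)) := by
  have hf1 : Differentiable ℝ f := hf.differentiable (by norm_num)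
  have hc1 : Differentiable ℝ c := hc.differentiable (by norm_num)
  have h1 : HasFDerivAt (fun z : PD n m => c (primal z)) ((fderiv ℝ c (primal z)).comp primalL) z :=
    (hc1 _).hasFDerivAt.comp z primalL.hasFDerivAt
  have h2 : HasFDerivAt (gradX f c) (fderiv ℝ (gradX f c) z) z :=
    ((contDiff_gradX hf hc).differentiable (by norm_num) z).hasFDerivAt
  have h3 : HasFDerivAt (merit f c η₁ η₂) _ z :=
    ((hasFDerivAt_lagrangian hf1 hc1 z).add (h1.norm_sq.const_mul (η₁ / 2))).add
      (h2.norm_sq.const_mul (η₂ / 2))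
  rw [inner_gradMerit_eq_fderiv, h3.fderiv, ← fderiv_gradX_apply hf hc, toEuclideanLin_jacobian]
  simp
  ring

end Calculus

/-- A uniform backtracking bound for a `C¹` function on a compact set. -/
theorem exists_armijo_bound {V : Type*} [NormedAddCommGroup V] [NormedSpace ℝ V]
    [FiniteDimensional ℝ V] {φ : V → ℝ} (hφ : ContDiff ℝ 1 φ) {Z : Set V} (hZ : IsCompact Z)
    {R ε β : ℝ} (hR : 0 < R) (hε : 0 < ε) (hβ : β < 1) :
    ∃ a > 0, ∀ z ∈ Z, ∀ u, ‖u‖ ≤ R → fderiv ℝ φ z u ≤ -ε → ∀ α, 0 < α → α ≤ a →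
      φ (z + α • u) ≤ φ z + α * β * fderiv ℝ φ z u := by
  have hcont : Continuous (fderiv ℝ φ) := hφ.continuous_fderiv (by norm_num)
  have huc := (hZ.cthickening (r := 1)).uniformContinuousOn_of_continuous hcont.continuousOn
  set κ : ℝ := (1 - β) * ε / R with hκ
  have hκpos : 0 < κ := div_pos (mul_pos (by linarith) hε) hR
  obtain ⟨d, hd, hdist⟩ := Metric.uniformContinuousOn_iff_le.mp huc κ hκpos
  have hm : 0 < min d 1 := lt_min hd one_pos
  refine ⟨min d 1 / R, by positivity, fun z hz u hu hdesc α hα hαa => ?_⟩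
  have hαR : α * R ≤ min d 1 := by rwa [le_div_iff₀ hR] at hαa
  have hαu : ‖α • u‖ ≤ min d 1 := by
    rw [norm_smul, Real.norm_of_nonneg hα.le]
    exact (mul_le_mul_of_nonneg_left hu hα.le).trans hαR
  have hmv := (convex_closedBall z (min d 1)).norm_image_sub_le_of_norm_fderiv_le'
    (f := φ) (φ := fderiv ℝ φ z) (C := κ) (x := z) (y := z + α • u)
    (fun x _ => hφ.differentiable (by norm_num) x)
    (fun x hx => by
      rw [← dist_eq_norm]
      rw [Metric.mem_closedBall] at hx
      refine hdist x ?_ z ?_ (hx.trans (min_le_left _ _))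
      · exact Metric.mem_cthickening_of_dist_le x z 1 Z hz (hx.trans (min_le_right _ _))
      · exact Metric.self_subset_cthickening Z hz)
    (Metric.mem_closedBall_self hm.le)
    (by rw [Metric.mem_closedBall, dist_eq_norm, add_sub_cancel_left]; exact hαu)
  rw [add_sub_cancel_left, map_smul, smul_eq_mul] at hmv
  have h1 := (le_abs_self _).trans hmv
  have h2 : κ * ‖α • u‖ ≤ α * ((1 - β) * ε) := by
    rw [norm_smul, Real.norm_of_nonneg hα.le]
    calc κ * (α * ‖u‖) ≤ κ * (α * R) := by gcongr
      _ = _ := by rw [hκ]; field_simp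
  have h3 : α * ((1 - β) * ε) ≤ -(α * ((1 - β) * fderiv ℝ φ z u)) := by
    have : 0 ≤ α * (1 - β) := mul_nonneg hα.le (by linarith)
    nlinarith [mul_le_mul_of_nonneg_left hdesc this]
  linarith

/-! ## Uniform estimates along the iteration -/

/-- Regularity of the KKT matrix at `z`: full row rank of the Jacobian, and symmetry,
boundedness and reduced positive definiteness of `B`. -/
def RegularAt {n m : ℕ} (c : EuclideanSpace ℝ (Fin n) → EuclideanSpace ℝ (Fin m))
    (ξG ξB ΥB : ℝ) (z : PD n m) (B : Matrix (Fin n) (Fin n) ℝ) : Prop :=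
  (∀ y : Fin m → ℝ, ξG * (y ⬝ᵥ y) ≤
      y ⬝ᵥ ((jacobian c (primal z) * (jacobian c (primal z)).transpose).mulVec y)) ∧
    B.IsSymm ∧
    (∀ u : Fin n → ℝ, (jacobian c (primal z)).mulVec u = 0 →
      ξB * (u ⬝ᵥ u) ≤ u ⬝ᵥ (B.mulVec u)) ∧
    opNorm B ≤ ΥB

theorem inner_eq_dotProduct {q : Type*} [Fintype q] (x y : EuclideanSpace ℝ q) :
    inner ℝ x y = x.ofLp ⬝ᵥ y.ofLp := by
  rw [EuclideanSpace.inner_eq_star_dotProduct, star_trivial, dotProduct_comm]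

section Estimates

variable {n m : ℕ} {f : EuclideanSpace ℝ (Fin n) → ℝ}
  {c : EuclideanSpace ℝ (Fin n) → EuclideanSpace ℝ (Fin m)} {p : Input n m}
  {ξG ξB ΥB : ℝ} {z : PD n m} {B : Matrix (Fin n) (Fin n) ℝ}

theorem RegularAt.lower (h : RegularAt c ξG ξB ΥB z B) (hξG : 0 < ξG)
    (y : EuclideanSpace ℝ (Fin m)) :
    √ξG * ‖y‖ ≤ ‖toEuclideanLin (jacobian c (primal z))ᵀ y‖ := by
  refine le_of_pow_le_pow_left₀ two_ne_zero (norm_nonneg _) ?_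
  rw [mul_pow, Real.sq_sqrt hξG.le, ← real_inner_self_eq_norm_sq, ← real_inner_self_eq_norm_sq,
    inner_toEuclideanLin_left, ← toEuclideanLin_mul_apply, transpose_transpose,
    inner_eq_dotProduct, inner_eq_dotProduct, toLpLin_apply]
  exact h.1 y.ofLp

theorem RegularAt.regularKKT (h : RegularAt c ξG ξB ΥB z B) (hξG : 0 < ξG) :
    RegularKKT (toEuclideanLin B) (toEuclideanLin (jacobian c (primal z)))
      (toEuclideanLin (jacobian c (primal z))ᵀ) √ξG ξB (max ΥB 0) where
  adjoint := inner_toEuclideanLin_left _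
  lower := h.lower hξG
  coercive x hx := by
    have h0 : (jacobian c (primal z)).mulVec x.ofLp = 0 := by
      simpa [toLpLin_apply] using congrArg WithLp.ofLp hx
    rw [← real_inner_self_eq_norm_sq, inner_eq_dotProduct, inner_eq_dotProduct, toLpLin_apply]
    exact h.2.2.1 x.ofLp h0
  bound x := (norm_toEuclideanLin_le B x).trans
    (mul_le_mul_of_nonneg_right (h.2.2.2.trans (le_max_left _ _)) (norm_nonneg _))

theorem RegularAt.leastSingularValue_pos (h : RegularAt c ξG ξB ΥB z B) (hm : 0 < m)
    (hξG : 0 < ξG) : 0 < leastSingularValue (jacobian c (primal z)) := by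
  have : Nonempty (Fin m) := ⟨⟨0, hm⟩⟩
  have hne : Nonempty (Metric.sphere (0 : EuclideanSpace ℝ (Fin m)) 1) :=
    (NormedSpace.sphere_nonempty.mpr zero_le_one).to_subtype
  refine lt_of_lt_of_le (Real.sqrt_pos.mpr hξG) (le_ciInf fun y => ?_)
  have := h.lower hξG y
  rwa [norm_eq_of_mem_sphere, mul_one] at this

theorem one_le_psi (hσ : 0 < leastSingularValue (jacobian c (primal z))) :
    1 ≤ psi c p z B := by
  have h1 : 0 < min p.ξB 1 := lt_min p.ξB_pos one_pos
  have h2 : 0 < min (leastSingularValue (jacobian c (primal z)) ^ 2) 1 :=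
    lt_min (by positivity) one_pos
  rw [psi, le_div_iff₀ (mul_pos h1 h2), one_mul]
  calc min p.ξB 1 * min (leastSingularValue (jacobian c (primal z)) ^ 2) 1 ≤ 1 * 1 :=
        mul_le_mul (min_le_right _ _) (min_le_right _ _) h2.le zero_le_one
    _ ≤ 20 * max (opNorm B ^ 2) 1 := by linarith [le_max_right (opNorm B ^ 2) 1]

theorem deltaTrial_pos (hσ : 0 < leastSingularValue (jacobian c (primal z))) {η₁ η₂ : ℝ}
    (h1 : 0 < η₁) (h2 : 0 < η₂) : 0 < deltaTrial f c p z B η₁ η₂ := by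
  have e1 : 0 < psi c p z B := one_pos.trans_le (one_le_psi hσ)
  have e2 : 0 < upsilon f c z := one_pos.trans_le (le_max_right _ _)
  have e3 : 0 < 1 / 2 - p.β := by linarith [p.β_mem.2]
  rw [deltaTrial]
  positivity

/-- The KKT matrices at regular points are uniformly invertible. -/
theorem exists_regularAt_inverse_bound
    (c : EuclideanSpace ℝ (Fin n) → EuclideanSpace ℝ (Fin m)) (hξG : 0 < ξG)
    (hξB : 0 < ξB) (ΥB : ℝ) :
    ∃ C > 0, ∀ z B, RegularAt c ξG ξB ΥB z B → ∀ u : PD n m,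
      ‖u‖ ≤ C * ‖toEuclideanLin (kktMatrix B (jacobian c (primal z))) u‖ := by
  obtain ⟨C, hC, h⟩ := exists_kkt_inverse_bound (EuclideanSpace ℝ (Fin n))
    (EuclideanSpace ℝ (Fin m)) (Real.sqrt_pos.mpr hξG) hξB (le_max_right ΥB 0)
  refine ⟨C * 2, by positivity, fun z B hreg u => ?_⟩
  have h1 := h _ _ _ (hreg.regularKKT hξG) (primal u) (dual u)
  rw [← primal_kktMatrix_apply, ← dual_kktMatrix_apply] at h1
  refine (norm_le_primal_add_dual u).trans (h1.trans ?_)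
  rw [mul_assoc]
  refine mul_le_mul_of_nonneg_left ?_ hC.le
  linarith [norm_primal_le (toEuclideanLin (kktMatrix B (jacobian c (primal z))) u),
    norm_dual_le (toEuclideanLin (kktMatrix B (jacobian c (primal z))) u)]

theorem exists_apply_eq_of_inverse_bound {V : Type*} [NormedAddCommGroup V] [NormedSpace ℝ V]
    [FiniteDimensional ℝ V] {T : V →ₗ[ℝ] V} {C : ℝ} (hT : ∀ u, ‖u‖ ≤ C * ‖T u‖) (v : V) :
    ∃ u, T u = v := by
  refine LinearMap.injective_iff_surjective.mp ?_ v
  rw [← LinearMap.ker_eq_bot, LinearMap.ker_eq_bot']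
  intro u hu
  have := hT u
  rw [hu, norm_zero, mul_zero] at this
  exact norm_le_zero_iff.mp this

theorem one_le_mul_opNorm {q : Type*} [Fintype q] [DecidableEq q] [Nonempty q]
    {Γ : Matrix q q ℝ} {C : ℝ} (hC : 0 < C)
    (hT : ∀ u : EuclideanSpace ℝ q, ‖u‖ ≤ C * ‖toEuclideanLin Γ u‖) : 1 ≤ C * opNorm Γ := by
  obtain ⟨u, hu⟩ := exists_ne (0 : EuclideanSpace ℝ q)
  have h0 : 0 < ‖u‖ := norm_pos_iff.mpr hu
  refine le_of_mul_le_mul_right ?_ h0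
  rw [one_mul, mul_assoc]
  exact (hT u).trans (mul_le_mul_of_nonneg_left (norm_toEuclideanLin_le Γ u) hC.le)

theorem AccuracyCond.residual_le {k : ℕ} {w : InnerState n m} (h : AccuracyCond f c p k z B w)
    (hm : 0 < m) (hσ : 0 < leastSingularValue (jacobian c (primal z))) (hδ : 0 ≤ w.δ)
    {C : ℝ} (hC : 0 < C) (hT : ∀ u : PD n m,
      ‖u‖ ≤ C * ‖toEuclideanLin (kktMatrix B (jacobian c (primal z))) u‖) :
    ‖newtonResidual (kktMatrix B (jacobian c (primal z))) (gradL f c z) w.u‖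
      ≤ C * w.δ * ‖gradL f c z‖ := by
  have : Nonempty (Fin n ⊕ Fin m) := ⟨Sum.inr ⟨0, hm⟩⟩
  have h1 := one_le_mul_opNorm hC hT
  have h2 : 1 ≤ psi c p z B := one_le_psi hσ
  have h3 : 0 < opNorm (kktMatrix B (jacobian c (primal z))) := by
    by_contra hneg
    push Not at hneg
    nlinarith
  refine h.trans ?_
  rw [div_le_iff₀ (by positivity)]
  have h4 : 1 ≤ C * (opNorm (kktMatrix B (jacobian c (primal z))) * psi c p z B) := by
    rw [← mul_assoc]; nlinarith
  have h5 : p.θ k * w.δ * ‖gradL f c z‖ ≤ w.δ * ‖gradL f c z‖ := by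
    rw [mul_assoc]
    exact mul_le_of_le_one_left (by positivity) (p.θ_mem k).2
  refine h5.trans ?_
  calc w.δ * ‖gradL f c z‖ = 1 * (w.δ * ‖gradL f c z‖) := (one_mul _).symm
    _ ≤ C * (opNorm (kktMatrix B (jacobian c (primal z))) * psi c p z B)
        * (w.δ * ‖gradL f c z‖) := mul_le_mul_of_nonneg_right h4 (by positivity)
    _ = _ := by ring

/-- The adaptive parameters after `a` updates. -/
structure AtLevel (p : Input n m) (a : ℕ) (η₁ η₂ δ : ℝ) : Prop where
  eta_one : η₁ = p.η₁₀ * p.ν ^ (2 * a)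
  eta_two : η₂ = p.η₂₀ / p.ν ^ a
  delta_pos : 0 < δ
  delta_le : δ ≤ 1 / p.ν ^ (4 * a)

theorem Input.ν_pos (p : Input n m) : 0 < p.ν := one_pos.trans p.one_lt_ν

theorem AtLevel.eta_one_pos {a : ℕ} {η₁ η₂ δ : ℝ} (h : AtLevel p a η₁ η₂ δ) : 0 < η₁ := by
  rw [h.eta_one]; exact mul_pos p.η₁₀_pos (pow_pos p.ν_pos _)

theorem AtLevel.eta_two_pos {a : ℕ} {η₁ η₂ δ : ℝ} (h : AtLevel p a η₁ η₂ δ) : 0 < η₂ := by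
  rw [h.eta_two]; exact div_pos p.η₂₀_pos (pow_pos p.ν_pos _)

theorem AtLevel.delta_le_one {a : ℕ} {η₁ η₂ δ : ℝ} (h : AtLevel p a η₁ η₂ δ) : δ ≤ 1 :=
  h.delta_le.trans (div_le_one_of_le₀ (one_le_pow₀ p.one_lt_ν.le) (pow_pos p.ν_pos _).le)

theorem AtLevel.unique {a b : ℕ} {η₁ η₂ δ η₁' δ' : ℝ} (h : AtLevel p a η₁ η₂ δ)
    (h' : AtLevel p b η₁' η₂ δ') : a = b := by
  have h1 := h.eta_two
  rw [h'.eta_two, div_eq_div_iff (pow_pos p.ν_pos _).ne' (pow_pos p.ν_pos _).ne'] at h1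
  exact pow_right_injective₀ p.ν_pos p.one_lt_ν.ne' (mul_left_cancel₀ p.η₂₀_pos.ne' h1)

/-- A bound for the directional derivatives of the augmented Lagrangian. -/
theorem inner_gradMerit_le (hf : ContDiff ℝ 2 f) (hc : ContDiff ℝ 2 c) {γ : ℝ}
    (h1 : ‖fderiv ℝ (gradX f c) z‖ ≤ γ) (h2 : ‖fderiv ℝ c (primal z)‖ ≤ γ) {η₁ η₂ : ℝ}
    (hη₁ : 0 < η₁) (hη₂ : 0 < η₂) (u : PD n m) :
    inner ℝ (gradMerit f c η₁ η₂ z) u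
      ≤ (1 + γ) * (1 + η₁ + η₂) * ‖gradL f c z‖ * ‖u‖ := by
  have hf1 : Differentiable ℝ f := hf.differentiable (by norm_num)
  have hc1 : Differentiable ℝ c := hc.differentiable (by norm_num)
  have hγ : 0 ≤ γ := (norm_nonneg _).trans h1
  rw [inner_gradMerit hf hc, ← inner_gradL hf1 hc1, ← fderiv_gradX_apply hf hc,
    toEuclideanLin_jacobian]
  have hg : ‖gradX f c z‖ ≤ ‖gradL f c z‖ := by
    conv_rhs => rw [gradL_eq_pair hf1 hc1]
    exact norm_primal_le (pair (gradX f c z) (c (primal z)))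
  have hcn : ‖c (primal z)‖ ≤ ‖gradL f c z‖ := by
    conv_rhs => rw [gradL_eq_pair hf1 hc1]
    exact norm_dual_le (pair (gradX f c z) (c (primal z)))
  have e1 := real_inner_le_norm (gradL f c z) u
  have e2 : inner ℝ (c (primal z)) (fderiv ℝ c (primal z) (primal u))
      ≤ ‖gradL f c z‖ * (γ * ‖u‖) := by
    refine (real_inner_le_norm _ _).trans (mul_le_mul hcn ?_ (norm_nonneg _) (norm_nonneg _))
    exact ((fderiv ℝ c (primal z)).le_opNorm _).trans
      (mul_le_mul h2 (norm_primal_le u) (norm_nonneg _) hγ)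
  have e3 : inner ℝ (gradX f c z) (fderiv ℝ (gradX f c) z u) ≤ ‖gradL f c z‖ * (γ * ‖u‖) := by
    refine (real_inner_le_norm _ _).trans (mul_le_mul hg ?_ (norm_nonneg _) (norm_nonneg _))
    exact ((fderiv ℝ (gradX f c) z).le_opNorm _).trans
      (mul_le_mul_of_nonneg_right h1 (norm_nonneg _))
  have e2' := mul_le_mul_of_nonneg_left e2 hη₁.le
  have e3' := mul_le_mul_of_nonneg_left e3 hη₂.le
  have e4 : 0 ≤ γ * (‖gradL f c z‖ * ‖u‖) + (η₁ + η₂) * (‖gradL f c z‖ * ‖u‖) := by positivity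
  linarith

theorem exists_level_bounds (p : Input n m) {e : ℝ} (he : 0 < e) (C K : ℝ) (hK : 0 ≤ K) :
    ∃ A : ℕ, ∀ a ≥ A, ∀ η₁ η₂ δ, AtLevel p a η₁ η₂ δ →
      η₂ ≤ e ∧ C ≤ η₁ * η₂ ∧ K * (1 + η₁ + η₂) * δ ≤ η₂ / 4 := by
  have ht := tendsto_pow_atTop_atTop_of_one_lt p.one_lt_ν
  have hη₁ := p.η₁₀_pos
  have hη₂ := p.η₂₀_pos
  set K' : ℝ := 4 * K * (1 + p.η₁₀ + p.η₂₀) with hK'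
  obtain ⟨A, hA⟩ := Filter.eventually_atTop.mp
    ((ht.eventually_ge_atTop (p.η₂₀ / e)).and
      ((ht.eventually_ge_atTop (C / (p.η₁₀ * p.η₂₀))).and (ht.eventually_ge_atTop (K' / p.η₂₀))))
  refine ⟨A, fun a ha η₁ η₂ δ h => ?_⟩
  obtain ⟨h1, h2, h3⟩ := hA a ha
  have hδ := h.delta_le
  have hδ0 := h.delta_pos
  rw [h.eta_one, h.eta_two]
  have hq1 : 1 ≤ p.ν ^ a := one_le_pow₀ p.one_lt_ν.le
  have e2 : p.ν ^ (2 * a) = (p.ν ^ a) ^ 2 := by rw [mul_comm, pow_mul]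
  have e4 : p.ν ^ (4 * a) = (p.ν ^ a) ^ 4 := by rw [mul_comm, pow_mul]
  rw [e4] at hδ
  rw [e2]
  set q := p.ν ^ a with hq
  have hq0 : 0 < q := by linarith
  refine ⟨?_, ?_, ?_⟩
  · rw [div_le_iff₀ he] at h1
    rw [div_le_iff₀ hq0]
    linarith
  · rw [div_le_iff₀ (by positivity)] at h2
    have : p.η₁₀ * q ^ 2 * (p.η₂₀ / q) = q * (p.η₁₀ * p.η₂₀) := by field_simp
    rw [this]; exact h2
  · have k1 : 1 + p.η₁₀ * q ^ 2 + p.η₂₀ / q ≤ (1 + p.η₁₀ + p.η₂₀) * q ^ 2 := by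
      have : p.η₂₀ / q ≤ p.η₂₀ * q ^ 2 := by
        rw [div_le_iff₀ hq0]
        have : 1 ≤ q ^ 2 * q := by nlinarith [sq_nonneg q, mul_le_mul hq1 hq1 zero_le_one hq0.le]
        nlinarith
      nlinarith
    calc K * (1 + p.η₁₀ * q ^ 2 + p.η₂₀ / q) * δ
        ≤ K * ((1 + p.η₁₀ + p.η₂₀) * q ^ 2) * (1 / q ^ 4) := by gcongr
      _ = K' / (4 * q ^ 2) := by rw [hK']; field_simp
      _ ≤ p.η₂₀ / q / 4 := by
        rw [div_le_iff₀ hη₂] at h3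
        rw [div_div, div_le_div_iff₀ (by positivity) (by positivity)]
        nlinarith

/-- After sufficiently many parameter updates, every sufficiently accurate direction is a
descent direction. -/
theorem exists_level_accuracy_imp_descent (hm : 0 < m) (hf : ContDiff ℝ 2 f)
    (hc : ContDiff ℝ 2 c) (p : Input n m) {Z : Set (PD n m)} (hZ : IsCompact Z) (hξG : 0 < ξG)
    (ΥB : ℝ) :
    ∃ A : ℕ, ∀ z ∈ Z, ∀ B, RegularAt c ξG p.ξB ΥB z B → ∀ k w, ∀ a ≥ A,
      AtLevel p a w.η₁ w.η₂ w.δ → AccuracyCond f c p k z B w → DescentCond f c z w := by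
  have hf1 : Differentiable ℝ f := hf.differentiable (by norm_num)
  have hc1 : Differentiable ℝ c := hc.differentiable (by norm_num)
  obtain ⟨C, hC, hinv⟩ := exists_regularAt_inverse_bound c hξG p.ξB_pos ΥB
  obtain ⟨γ₁, hγ₁⟩ := hZ.exists_bound_of_continuousOn
    ((contDiff_gradX hf hc).continuous_fderiv (by norm_num)).continuousOn
  obtain ⟨γ₂, hγ₂⟩ := hZ.exists_bound_of_continuousOn (f := fun z => fderiv ℝ c (primal z))
    ((hc.continuous_fderiv (by norm_num)).comp primalL.continuous).continuousOn
  set γ := max (max γ₁ γ₂) 0 with hγ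
  have hγ0 : 0 ≤ γ := le_max_right _ _
  obtain ⟨e, he, D, hdesc⟩ := exists_exact_descent (EuclideanSpace ℝ (Fin n))
    (EuclideanSpace ℝ (Fin m)) (Real.sqrt_pos.mpr hξG) p.ξB_pos (le_max_right ΥB 0) hγ0
  obtain ⟨A, hA⟩ := exists_level_bounds p he D ((1 + γ) * C * C) (by positivity)
  refine ⟨A, fun z hz B hreg k w a ha hlev hacc => ?_⟩
  obtain ⟨h1, h2, h3⟩ := hA a ha _ _ _ hlev
  have hη₁ := hlev.eta_one_pos
  have hη₂ := hlev.eta_two_pos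
  have g1 : ‖fderiv ℝ (gradX f c) z‖ ≤ γ :=
    (hγ₁ z hz).trans ((le_max_left _ _).trans (le_max_left _ _))
  have g2 : ‖fderiv ℝ c (primal z)‖ ≤ γ :=
    (hγ₂ z hz).trans ((le_max_right _ _).trans (le_max_left _ _))
  have hT := hinv z B hreg
  have hr := hacc.residual_le hm (hreg.leastSingularValue_pos hm hξG) hlev.delta_pos.le hC hT
  obtain ⟨us, hus⟩ := exists_apply_eq_of_inverse_bound hT (-gradL f c z)
  have hx := congrArg primal hus
  have hl := congrArg dual hus
  rw [primal_kktMatrix_apply, gradL_eq_pair hf1 hc1] at hx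
  rw [dual_kktMatrix_apply, gradL_eq_pair hf1 hc1] at hl
  have hexact := hdesc _ _ _ (hreg.regularKKT hξG) (hessX f c z)
    (fun x => (norm_hessX_apply_le z x).trans (mul_le_mul_of_nonneg_right g1 (norm_nonneg _)))
    (primal us) (gradX f c z) (dual us) (c (primal z)) w.η₁ w.η₂ hη₂ h1 h2 hx hl
  rw [← inner_gradMerit hf hc] at hexact
  have hnorm : ‖gradX f c z‖ ^ 2 + ‖c (primal z)‖ ^ 2 = ‖gradL f c z‖ ^ 2 := by
    rw [gradL_eq_pair hf1 hc1, norm_sq_eq_primal_add_dual]; rfl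
  rw [hnorm] at hexact
  have hdiff : ‖w.u - us‖ ≤ C * (C * w.δ * ‖gradL f c z‖) := by
    refine (hT _).trans (mul_le_mul_of_nonneg_left ?_ hC.le)
    rw [map_sub, hus, sub_neg_eq_add]
    exact hr
  have herr := inner_gradMerit_le hf hc g1 g2 hη₁ hη₂ (w.u - us)
  have herr2 : (1 + γ) * (1 + w.η₁ + w.η₂) * ‖gradL f c z‖ * ‖w.u - us‖
      ≤ w.η₂ / 4 * ‖gradL f c z‖ ^ 2 := by
    calc _ ≤ (1 + γ) * (1 + w.η₁ + w.η₂) * ‖gradL f c z‖ * (C * (C * w.δ * ‖gradL f c z‖)) :=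
          mul_le_mul_of_nonneg_left hdiff (by positivity)
      _ = ((1 + γ) * C * C * (1 + w.η₁ + w.η₂) * w.δ) * ‖gradL f c z‖ ^ 2 := by ring
      _ ≤ _ := mul_le_mul_of_nonneg_right h3 (by positivity)
  have hsplit : inner ℝ (gradMerit f c w.η₁ w.η₂ z) w.u
      = inner ℝ (gradMerit f c w.η₁ w.η₂ z) us
        + inner ℝ (gradMerit f c w.η₁ w.η₂ z) (w.u - us) := by
    rw [← inner_add_right, add_sub_cancel]
  rw [DescentCond, hsplit]
  linarith

end Estimates

/-! ## Termination of the inner loops and of the line search -/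

section Inner

variable {n m : ℕ} {f : EuclideanSpace ℝ (Fin n) → ℝ}
  {c : EuclideanSpace ℝ (Fin n) → EuclideanSpace ℝ (Fin m)} {p : Input n m}
  {k : ℕ} {z : PD n m} {B : Matrix (Fin n) (Fin n) ℝ} {S : ℕ → Sketch n m}

theorem innerStep_of_not_accuracyCond {w : InnerState n m} (h : ¬ AccuracyCond f c p k z B w) :
    innerStep f c p k z B S w =
      { w with
        j := w.j + 1
        u := sketchStep (kktMatrix B (jacobian c (primal z))) (gradL f c z) (S w.j) w.u } := by
  rw [innerStep, if_neg h]

theorem innerStep_of_not_descentCond {w : InnerState n m} (h : AccuracyCond f c p k z B w)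
    (h' : ¬ DescentCond f c z w) :
    innerStep f c p k z B S w =
      { w with
        η₁ := w.η₁ * p.ν ^ 2
        η₂ := w.η₂ / p.ν
        δ := min (w.δ / p.ν ^ 4) (deltaTrial f c p z B (w.η₁ * p.ν ^ 2) (w.η₂ / p.ν)) } := by
  rw [innerStep, if_pos h, if_neg h']

theorem innerStep_of_done {w : InnerState n m} (h : AccuracyCond f c p k z B w)
    (h' : DescentCond f c z w) : innerStep f c p k z B S w = w := by
  rw [innerStep, if_pos h, if_pos h']

theorem AtLevel.update (hσ : 0 < leastSingularValue (jacobian c (primal z))) {a : ℕ}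
    {η₁ η₂ δ : ℝ} (h : AtLevel p a η₁ η₂ δ) :
    AtLevel p (a + 1) (η₁ * p.ν ^ 2) (η₂ / p.ν)
      (min (δ / p.ν ^ 4) (deltaTrial f c p z B (η₁ * p.ν ^ 2) (η₂ / p.ν))) where
  eta_one := by rw [h.eta_one]; ring
  eta_two := by rw [h.eta_two, div_div, pow_succ]
  delta_pos := lt_min (div_pos h.delta_pos (pow_pos p.ν_pos _))
    (deltaTrial_pos hσ (mul_pos h.eta_one_pos (pow_pos p.ν_pos _))
      (div_pos h.eta_two_pos p.ν_pos))
  delta_le := by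
    refine (min_le_left _ _).trans ?_
    rw [mul_add, pow_add, ← div_div]
    exact div_le_div_of_nonneg_right h.delta_le (pow_pos p.ν_pos _).le

/-- Each elementary step keeps the level or, if it is below `A`, raises it by one. -/
theorem exists_level_innerStep (hσ : 0 < leastSingularValue (jacobian c (primal z))) {A : ℕ}
    (hA : ∀ w, ∀ a ≥ A, AtLevel p a w.η₁ w.η₂ w.δ → AccuracyCond f c p k z B w →
      DescentCond f c z w)
    {a : ℕ} {w : InnerState n m} (h : AtLevel p a w.η₁ w.η₂ w.δ) (ha : a ≤ A) :
    ∃ a' ≥ a, a' ≤ A ∧ AtLevel p a' (innerStep f c p k z B S w).η₁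
      (innerStep f c p k z B S w).η₂ (innerStep f c p k z B S w).δ := by
  by_cases h1 : AccuracyCond f c p k z B w
  · by_cases h2 : DescentCond f c z w
    · exact ⟨a, le_rfl, ha, by rwa [innerStep_of_done h1 h2]⟩
    · have hlt : a < A := by
        by_contra hge
        exact h2 (hA w a (not_lt.mp hge) h h1)
      refine ⟨a + 1, by omega, hlt, ?_⟩
      rw [innerStep_of_not_descentCond h1 h2]
      exact h.update hσ
  · refine ⟨a, le_rfl, ha, ?_⟩
    rw [innerStep_of_not_accuracyCond h1]
    exact h

theorem exists_level_iterate (hσ : 0 < leastSingularValue (jacobian c (primal z))) {A : ℕ}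
    (hA : ∀ w, ∀ a ≥ A, AtLevel p a w.η₁ w.η₂ w.δ → AccuracyCond f c p k z B w →
      DescentCond f c z w)
    {a : ℕ} {w : InnerState n m} (h : AtLevel p a w.η₁ w.η₂ w.δ) (ha : a ≤ A) (t : ℕ) :
    ∃ a' ≥ a, a' ≤ A ∧ AtLevel p a' ((innerStep f c p k z B S)^[t] w).η₁
      ((innerStep f c p k z B S)^[t] w).η₂ ((innerStep f c p k z B S)^[t] w).δ := by
  induction t with
  | zero => exact ⟨a, le_rfl, ha, h⟩
  | succ t ih =>
    obtain ⟨a', h1, h2, h3⟩ := ih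
    obtain ⟨a'', h4, h5, h6⟩ := exists_level_innerStep (S := S) hσ hA h3 h2
    rw [Function.iterate_succ_apply']
    exact ⟨a'', h1.trans h4, h5, h6⟩

theorem iterate_of_not_accuracyCond {w : InnerState n m} {t : ℕ}
    (h : ∀ i < t, ¬ AccuracyCond f c p k z B ((innerStep f c p k z B S)^[i] w)) :
    ((innerStep f c p k z B S)^[t] w).j = w.j + t ∧
      ((innerStep f c p k z B S)^[t] w).η₁ = w.η₁ ∧
      ((innerStep f c p k z B S)^[t] w).η₂ = w.η₂ ∧
      ((innerStep f c p k z B S)^[t] w).δ = w.δ := by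
  induction t with
  | zero => exact ⟨rfl, rfl, rfl, rfl⟩
  | succ t ih =>
    obtain ⟨h1, h2, h3, h4⟩ := ih fun i hi => h i (by omega)
    rw [Function.iterate_succ_apply', innerStep_of_not_accuracyCond (h t (by omega))]
    exact ⟨by simp only [h1]; ring, h2, h3, h4⟩

/-- With a recurrent sequence of sketches, the accuracy condition is eventually met. -/
theorem exists_accuracyCond (hS : Recurrent S)
    (hsymm : (kktMatrix B (jacobian c (primal z))).IsSymm)
    (hsol : ∃ us, toEuclideanLin (kktMatrix B (jacobian c (primal z))) us = -gradL f c z)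
    (hpsi : 0 < psi c p z B) (hop : 0 < opNorm (kktMatrix B (jacobian c (primal z))))
    (hg : gradL f c z ≠ 0) (w : InnerState n m) (hδ : 0 < w.δ) :
    ∃ t, AccuracyCond f c p k z B ((innerStep f c p k z B S)^[t] w) := by
  by_contra! h
  obtain ⟨us, hus⟩ := hsol
  have hgn : 0 < ‖gradL f c z‖ := norm_pos_iff.mpr hg
  have hθ := (p.θ_mem k).1
  obtain ⟨t, ht⟩ := hS.exists_residual_le hsymm hus w.j
    (fun t => ((innerStep f c p k z B S)^[t] w).u)
    (fun t => by
      have hj := (iterate_of_not_accuracyCond (t := t) fun i _ => h i).1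
      simp only [Function.iterate_succ_apply']
      rw [innerStep_of_not_accuracyCond (h t), hj])
    (ε := p.θ k * w.δ * ‖gradL f c z‖ /
      (opNorm (kktMatrix B (jacobian c (primal z))) * psi c p z B)) (by positivity)
  refine h t ?_
  rw [AccuracyCond, (iterate_of_not_accuracyCond (t := t) fun i _ => h i).2.2.2]
  exact ht

/-- The nested loops terminate. -/
theorem exists_accuracyCond_and_descentCond (hS : Recurrent S)
    (hsymm : (kktMatrix B (jacobian c (primal z))).IsSymm)
    (hsol : ∃ us, toEuclideanLin (kktMatrix B (jacobian c (primal z))) us = -gradL f c z)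
    (hσ : 0 < leastSingularValue (jacobian c (primal z)))
    (hop : 0 < opNorm (kktMatrix B (jacobian c (primal z)))) (hg : gradL f c z ≠ 0) {A : ℕ}
    (hA : ∀ w, ∀ a ≥ A, AtLevel p a w.η₁ w.η₂ w.δ → AccuracyCond f c p k z B w →
      DescentCond f c z w) (d : ℕ) :
    ∀ (a : ℕ) (w : InnerState n m), AtLevel p a w.η₁ w.η₂ w.δ → A ≤ a + d →
      ∃ t, AccuracyCond f c p k z B ((innerStep f c p k z B S)^[t] w) ∧
        DescentCond f c z ((innerStep f c p k z B S)^[t] w) := by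
  classical
  induction d with
  | zero =>
    intro a w h ha
    have hex := exists_accuracyCond (p := p) (k := k) hS hsymm hsol (one_pos.trans_le (one_le_psi hσ)) hop
      hg w h.delta_pos
    obtain ⟨-, h1, h2, h3⟩ := iterate_of_not_accuracyCond fun i hi => Nat.find_min hex hi
    refine ⟨Nat.find hex, Nat.find_spec hex, hA _ a ha ?_ (Nat.find_spec hex)⟩
    rwa [h1, h2, h3]
  | succ d ih =>
    intro a w h ha
    have hex := exists_accuracyCond (p := p) (k := k) hS hsymm hsol (one_pos.trans_le (one_le_psi hσ)) hop
      hg w h.delta_pos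
    obtain ⟨-, h1, h2, h3⟩ := iterate_of_not_accuracyCond fun i hi => Nat.find_min hex hi
    by_cases hd : DescentCond f c z ((innerStep f c p k z B S)^[Nat.find hex] w)
    · exact ⟨Nat.find hex, Nat.find_spec hex, hd⟩
    have hlev : AtLevel p a ((innerStep f c p k z B S)^[Nat.find hex] w).η₁
        ((innerStep f c p k z B S)^[Nat.find hex] w).η₂
        ((innerStep f c p k z B S)^[Nat.find hex] w).δ := by rwa [h1, h2, h3]
    obtain ⟨t, ht⟩ := ih (a + 1)
      (innerStep f c p k z B S ((innerStep f c p k z B S)^[Nat.find hex] w))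
      (by rw [innerStep_of_not_descentCond (Nat.find_spec hex) hd]; exact hlev.update hσ)
      (by omega)
    refine ⟨t + 1 + Nat.find hex, ?_⟩
    rw [Function.iterate_add_apply, Function.iterate_succ_apply]
    exact ht

/-- At a stationary point the zero direction is accepted. -/
theorem accepted_zero_of_gradL_eq_zero {s : State n m} (hg : gradL f c s.z = 0) :
    Accepted f c p k B S s 0 := by
  constructor
  · simp [AccuracyCond, innerIter, innerInit, newtonResidual, hg]
  · simp [DescentCond, innerIter, innerInit, hg]

end Inner

/-- The properties of one outer iteration that the convergence proof uses. -/
structure StepProps {n m : ℕ} (f : EuclideanSpace ℝ (Fin n) → ℝ)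
    (c : EuclideanSpace ℝ (Fin n) → EuclideanSpace ℝ (Fin m)) (p : Input n m) (R : ℝ)
    (s s' : State n m) (i : ℕ) (u : PD n m) : Prop where
  z_eq : s'.z = s.z + p.ρ ^ i • u
  norm_le : ‖u‖ ≤ R
  descent : fderiv ℝ (merit f c s'.η₁ s'.η₂) s.z u ≤ -(s'.η₂ * ‖gradL f c s.z‖ ^ 2 / 2)
  armijo : merit f c s'.η₁ s'.η₂ (s.z + p.ρ ^ i • u) ≤
    merit f c s'.η₁ s'.η₂ s.z + p.ρ ^ i * p.β * fderiv ℝ (merit f c s'.η₁ s'.η₂) s.z u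
  first : ∀ j < i, ¬ merit f c s'.η₁ s'.η₂ (s.z + p.ρ ^ j • u) ≤
    merit f c s'.η₁ s'.η₂ s.z + p.ρ ^ j * p.β * fderiv ℝ (merit f c s'.η₁ s'.η₂) s.z u

theorem exists_outerStep {n m : ℕ} {f : EuclideanSpace ℝ (Fin n) → ℝ}
    {c : EuclideanSpace ℝ (Fin n) → EuclideanSpace ℝ (Fin m)} (hm : 0 < m)
    (hf : ContDiff ℝ 2 f) (hc : ContDiff ℝ 2 c) (p : Input n m) {Z : Set (PD n m)}
    (hZ : IsCompact Z) {ξG : ℝ} (hξG : 0 < ξG) (ΥB : ℝ) :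
    ∃ (A : ℕ) (R : ℝ), 0 < R ∧ ∀ (k : ℕ) (B : Matrix (Fin n) (Fin n) ℝ) (S : ℕ → Sketch n m)
      (s : State n m) (a : ℕ), s.z ∈ Z → RegularAt c ξG p.ξB ΥB s.z B → Recurrent S →
      AtLevel p a s.η₁ s.η₂ s.δ → a ≤ A →
      ∃ s', outerStep f c p k B S s = some s' ∧
        (∃ a' ≥ a, a' ≤ A ∧ AtLevel p a' s'.η₁ s'.η₂ s'.δ) ∧ ∃ i u, StepProps f c p R s s' i u := by
  classical
  have hf1 : Differentiable ℝ f := hf.differentiable (by norm_num)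
  have hc1 : Differentiable ℝ c := hc.differentiable (by norm_num)
  obtain ⟨C, hC, hinv⟩ := exists_regularAt_inverse_bound c hξG p.ξB_pos ΥB
  obtain ⟨A, hA⟩ := exists_level_accuracy_imp_descent hm hf hc p hZ hξG ΥB
  have hgc : Continuous (gradL f c) :=
    (InnerProductSpace.toDual ℝ (PD n m)).symm.continuous.comp
      (ContDiff.continuous_fderiv (n := 1) (by
        have h := contDiff_merit hf hc (n := n) (m := m) 0 0
        have e : (merit f c 0 0 : PD n m → ℝ) = lagrangian f c := by
          funext z; simp [merit]
        rwa [e] at h) (by norm_num))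
  obtain ⟨L, hL⟩ := hZ.exists_bound_of_continuousOn hgc.continuousOn
  refine ⟨A, C * (C * |L| + |L|) + 1, by positivity, fun k B S s a hz hreg hS hlev ha => ?_⟩
  have : Nonempty (Fin n ⊕ Fin m) := ⟨Sum.inr ⟨0, hm⟩⟩
  have hσ := hreg.leastSingularValue_pos hm hξG
  have hT := hinv s.z B hreg
  have hop : 0 < opNorm (kktMatrix B (jacobian c (primal s.z))) :=
    pos_of_mul_pos_right (one_pos.trans_le (one_le_mul_opNorm hC hT)) hC.le
  have hlev0 : AtLevel p a (innerInit f c p B s).η₁ (innerInit f c p B s).η₂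
      (innerInit f c p B s).δ :=
    ⟨hlev.eta_one, hlev.eta_two,
      lt_min hlev.delta_pos (deltaTrial_pos hσ hlev.eta_one_pos hlev.eta_two_pos),
      (min_le_left _ _).trans hlev.delta_le⟩
  have hA' := fun w => hA s.z hz B hreg k w
  have hacc : ∃ t, Accepted f c p k B S s t := by
    by_cases hg : gradL f c s.z = 0
    · exact ⟨0, accepted_zero_of_gradL_eq_zero hg⟩
    · exact exists_accuracyCond_and_descentCond hS (kktMatrix_isSymm hreg.2.1 _)
        (exists_apply_eq_of_inverse_bound hT _) hσ hop hg hA' A a _ hlev0 (by omega)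
  obtain ⟨a', haa', ha'A, hlev'⟩ := exists_level_iterate (S := S) hσ hA' hlev0 ha (Nat.find hacc)
  obtain ⟨hac, hdc⟩ := Nat.find_spec hacc
  set w : InnerState n m := innerIter f c p k B S s (Nat.find hacc) with hw
  have hlev'' : AtLevel p a' w.η₁ w.η₂ w.δ := hlev'
  have hr := hac.residual_le hm hσ hlev''.delta_pos.le hC hT
  have hun : ‖w.u‖ ≤ C * (C * w.δ * ‖gradL f c s.z‖ + ‖gradL f c s.z‖) := by
    refine (hT _).trans (mul_le_mul_of_nonneg_left ?_ hC.le)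
    have e : toEuclideanLin (kktMatrix B (jacobian c (primal s.z))) w.u
        = newtonResidual (kktMatrix B (jacobian c (primal s.z))) (gradL f c s.z) w.u
          - gradL f c s.z := by
      rw [newtonResidual]; abel
    rw [e]
    exact (norm_sub_le _ _).trans (add_le_add hr le_rfl)
  have hgL : ‖gradL f c s.z‖ ≤ |L| := (hL _ hz).trans (le_abs_self L)
  have hδ1 := hlev''.delta_le_one
  have hδ0 := hlev''.delta_pos
  have huR : ‖w.u‖ ≤ C * (C * |L| + |L|) + 1 := by
    have : C * w.δ * ‖gradL f c s.z‖ ≤ C * |L| := by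
      refine mul_le_mul ?_ hgL (norm_nonneg _) hC.le
      exact mul_le_of_le_one_right hC.le hδ1
    have := mul_le_mul_of_nonneg_left (add_le_add this hgL) hC.le
    linarith
  have hls : ∃ i : ℕ, Armijo f c p s.z w (p.ρ ^ i) := by
    by_cases hg : gradL f c s.z = 0
    · have hu0 : w.u = 0 := by
        rw [hg, norm_zero, mul_zero, add_zero, mul_zero] at hun
        exact norm_le_zero_iff.mp hun
      exact ⟨0, by simp [Armijo, hu0]⟩
    · have hgn : 0 < ‖gradL f c s.z‖ := norm_pos_iff.mpr hg
      have hη₂ := hlev''.eta_two_pos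
      obtain ⟨α, hα, h⟩ := exists_armijo_bound (contDiff_merit hf hc w.η₁ w.η₂)
        (isCompact_singleton (x := s.z)) (R := C * (C * |L| + |L|) + 1)
        (ε := w.η₂ * ‖gradL f c s.z‖ ^ 2 / 2) (β := p.β) (by positivity) (by positivity)
        (by linarith [p.β_mem.2])
      obtain ⟨i, hi⟩ := exists_pow_lt_of_lt_one hα p.ρ_mem.2
      refine ⟨i, ?_⟩
      rw [Armijo, inner_gradMerit_eq_fderiv]
      refine h s.z rfl w.u huR ?_ _ (pow_pos p.ρ_mem.1 i) hi.le
      rw [← inner_gradMerit_eq_fderiv]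
      exact hdc
  refine ⟨{ z := s.z + p.ρ ^ Nat.find hls • w.u, η₁ := w.η₁, η₂ := w.η₂, δ := w.δ }, ?_,
    ⟨a', haa', ha'A, hlev''⟩, Nat.find hls, w.u, ?_⟩
  · rw [outerStep, dif_pos hacc]
    simp only
    rw [dif_pos hls]
  · refine ⟨rfl, huR, ?_, ?_, fun j hj => ?_⟩
    · rw [← inner_gradMerit_eq_fderiv]; exact hdc
    · rw [← inner_gradMerit_eq_fderiv]; exact Nat.find_spec hls
    · rw [← inner_gradMerit_eq_fderiv]; exact Nat.find_min hls hj

/-! ## Global convergence -/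

theorem tendsto_zero_of_sufficient_decrease {M g : ℕ → ℝ} (hg : ∀ k, 0 ≤ g k) {N : ℕ} {b : ℝ}
    (hb : ∀ k, b ≤ M k) (hanti : ∀ k ≥ N, M (k + 1) ≤ M k)
    (hdec : ∀ ε > 0, ∃ d > 0, ∀ k ≥ N, ε ≤ g k → M (k + 1) ≤ M k - d) :
    Filter.Tendsto g Filter.atTop (nhds 0) := by
  have hanti' : Antitone fun k => M (k + N) := antitone_nat_of_succ_le fun k => by
    rw [add_right_comm]; exact hanti _ (by omega)
  have hlim := tendsto_atTop_ciInf hanti' ⟨b, by rintro _ ⟨k, rfl⟩; exact hb _⟩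
  have hdiff := hlim.sub (hlim.comp (Filter.tendsto_add_atTop_nat 1))
  rw [sub_self] at hdiff
  rw [Metric.tendsto_atTop]
  intro ε hε
  obtain ⟨d, hd, h⟩ := hdec ε hε
  obtain ⟨K, hK⟩ := Filter.eventually_atTop.mp (hdiff.eventually_lt_const hd)
  refine ⟨K + N, fun k hk => ?_⟩
  rw [dist_zero_right, Real.norm_of_nonneg (hg k)]
  by_contra hge
  have h1 := h k (by omega) (not_lt.mp hge)
  have h2 := hK (k - N) (by omega)
  simp only [Function.comp_apply] at h2
  rw [show k - N + 1 + N = k + 1 by omega, show k - N + N = k by omega] at h2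
  linarith

theorem eventually_const_of_monotone_of_le {a : ℕ → ℕ} (ha : Monotone a) {A : ℕ}
    (hA : ∀ k, a k ≤ A) : ∃ N b, ∀ k ≥ N, a k = b := by
  have h := tendsto_atTop_ciSup ha ⟨A, by rintro _ ⟨k, rfl⟩; exact hA k⟩
  rw [nhds_discrete, Filter.tendsto_pure] at h
  obtain ⟨N, hN⟩ := Filter.eventually_atTop.mp h
  exact ⟨N, _, hN⟩

theorem StepProps.decrease {n m : ℕ} {f : EuclideanSpace ℝ (Fin n) → ℝ}
    {c : EuclideanSpace ℝ (Fin n) → EuclideanSpace ℝ (Fin m)} {p : Input n m} {R : ℝ}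
    {s s' : State n m} {i : ℕ} {u : PD n m} (h : StepProps f c p R s s' i u) :
    merit f c s'.η₁ s'.η₂ s'.z ≤ merit f c s'.η₁ s'.η₂ s.z
      - p.ρ ^ i * p.β * (s'.η₂ * ‖gradL f c s.z‖ ^ 2 / 2) := by
  have h1 := h.armijo
  have h2 := mul_le_mul_of_nonneg_left h.descent
    (mul_nonneg (pow_pos p.ρ_mem.1 i).le p.β_mem.1.le)
  rw [h.z_eq]
  linarith

/-- The deterministic part: with recurrent sketches, the algorithm is well defined and the
gradients of the Lagrangian tend to zero. -/
theorem exists_run_tendsto {n m : ℕ} (hm : 0 < m)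
    {f : EuclideanSpace ℝ (Fin n) → ℝ} {c : EuclideanSpace ℝ (Fin n) → EuclideanSpace ℝ (Fin m)}
    (hf : ContDiff ℝ 2 f) (hc : ContDiff ℝ 2 c) (p : Input n m)
    (B : ℕ → Matrix (Fin n) (Fin n) ℝ) (S : ℕ → ℕ → Sketch n m) {Z : Set (PD n m)}
    (hZ : IsCompact Z) {ξG ΥB : ℝ} (hξG : 0 < ξG)
    (hiter : ∀ k s, run f c p B S k = some s → s.z ∈ Z)
    (hreg : ∀ k s, run f c p B S k = some s → RegularAt c ξG p.ξB ΥB s.z (B k))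
    (hS : ∀ k, Recurrent (S k)) :
    ∃ s : ℕ → State n m, (∀ k, run f c p B S k = some (s k)) ∧
      Filter.Tendsto (fun k => ‖gradL f c (s k).z‖) Filter.atTop (nhds 0) := by
  obtain ⟨A, R, hR, hstep⟩ := exists_outerStep hm hf hc p hZ hξG ΥB
  have hrun : ∀ k, ∃ s, run f c p B S k = some s ∧ ∃ a ≤ A, AtLevel p a s.η₁ s.η₂ s.δ := by
    intro k
    induction k with
    | zero =>
      exact ⟨_, rfl, 0, Nat.zero_le _, by simp, by simp, p.δ₀_mem.1, by simpa using p.δ₀_mem.2.le⟩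
    | succ k ih =>
      obtain ⟨s, hs, a, ha, hlev⟩ := ih
      obtain ⟨s', hs', ⟨a', -, ha', hlev'⟩, -⟩ :=
        hstep k (B k) (S k) s a (hiter k s hs) (hreg k s hs) (hS k) hlev ha
      exact ⟨s', by rw [run, hs]; exact hs', a', ha', hlev'⟩
  choose s hs a ha hlev using hrun
  have hnext : ∀ k, a k ≤ a (k + 1) ∧ ∃ i u, StepProps f c p R (s k) (s (k + 1)) i u := by
    intro k
    obtain ⟨s', hs', ⟨a', haa', -, hlev'⟩, hprops⟩ :=
      hstep k (B k) (S k) (s k) (a k) (hiter k _ (hs k)) (hreg k _ (hs k)) (hS k) (hlev k) (ha k)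
    have hk := hs (k + 1)
    rw [run, hs k, Option.bind_some, hs', Option.some_inj] at hk
    subst hk
    exact ⟨haa'.trans_eq (hlev'.unique (hlev (k + 1))), hprops⟩
  refine ⟨s, hs, ?_⟩
  obtain ⟨N, b, hN⟩ := eventually_const_of_monotone_of_le
    (monotone_nat_of_le_succ fun k => (hnext k).1) ha
  set η₁ := p.η₁₀ * p.ν ^ (2 * b) with hη₁
  set η₂ := p.η₂₀ / p.ν ^ b with hη₂
  have hη₂pos : 0 < η₂ := div_pos p.η₂₀_pos (pow_pos p.ν_pos _)
  have he1 : ∀ k ≥ N, (s k).η₁ = η₁ := fun k hk => by rw [(hlev k).eta_one, hN k hk]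
  have he2 : ∀ k ≥ N, (s k).η₂ = η₂ := fun k hk => by rw [(hlev k).eta_two, hN k hk]
  have hzZ : ∀ k, (s k).z ∈ Z := fun k => hiter k _ (hs k)
  have hρ := p.ρ_mem.1
  have hβ := p.β_mem.1
  obtain ⟨l, hl⟩ := hZ.exists_bound_of_continuousOn
    (contDiff_merit hf hc η₁ η₂).continuous.continuousOn
  refine tendsto_zero_of_sufficient_decrease (M := fun k => merit f c η₁ η₂ (s k).z) (N := N)
    (b := -l) (fun k => norm_nonneg _) (fun k => neg_le_of_abs_le (hl _ (hzZ k))) ?_ ?_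
  · intro k hk
    obtain ⟨-, i, u, hp⟩ := hnext k
    have hd := hp.decrease
    rw [he1 _ (by omega), he2 _ (by omega)] at hd
    have : 0 ≤ p.ρ ^ i * p.β * (η₂ * ‖gradL f c (s k).z‖ ^ 2 / 2) := by positivity
    linarith
  · intro ε hε
    obtain ⟨α, hα, harm⟩ := exists_armijo_bound (contDiff_merit hf hc η₁ η₂) hZ hR
      (ε := η₂ * ε ^ 2 / 2) (β := p.β) (by positivity) (by linarith [p.β_mem.2])
    have hαpos : 0 < min 1 (p.ρ * α) := lt_min one_pos (by positivity)
    refine ⟨min 1 (p.ρ * α) * p.β * (η₂ * ε ^ 2 / 2), by positivity, fun k hk hge => ?_⟩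
    obtain ⟨-, i, u, hp⟩ := hnext k
    have hd := hp.decrease
    have hfirst := hp.first
    have hdesc := hp.descent
    rw [he1 _ (by omega), he2 _ (by omega)] at hd hdesc
    rw [he1 (k + 1) (by omega), he2 (k + 1) (by omega)] at hfirst
    have hsq : η₂ * ε ^ 2 / 2 ≤ η₂ * ‖gradL f c (s k).z‖ ^ 2 / 2 := by gcongr
    have hi : min 1 (p.ρ * α) ≤ p.ρ ^ i := by
      cases i with
      | zero => rw [pow_zero]; exact min_le_left _ _
      | succ i =>
        have hlt : α < p.ρ ^ i := by
          by_contra hle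
          exact hfirst i (Nat.lt_succ_self i) (harm _ (hzZ k) u hp.norm_le (by linarith) _
            (pow_pos hρ i) (not_lt.mp hle))
        refine (min_le_right _ _).trans ?_
        rw [pow_succ']
        exact mul_le_mul_of_nonneg_left hlt.le hρ.le
    have : min 1 (p.ρ * α) * p.β * (η₂ * ε ^ 2 / 2)
        ≤ p.ρ ^ i * p.β * (η₂ * ‖gradL f c (s k).z‖ ^ 2 / 2) := by gcongr
    linarith

theorem isCompact_primal_dual {n m : ℕ} {X : Set (EuclideanSpace ℝ (Fin n))}
    {Λ : Set (EuclideanSpace ℝ (Fin m))} (hX : IsCompact X) (hΛ : IsCompact Λ) :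
    IsCompact {z : PD n m | primal z ∈ X ∧ dual z ∈ Λ} := by
  obtain ⟨a, ha⟩ := hX.isBounded.exists_norm_le
  obtain ⟨b, hb⟩ := hΛ.isBounded.exists_norm_le
  refine Metric.isCompact_of_isClosed_isBounded ?_ ?_
  · exact (hX.isClosed.preimage primalL.continuous).inter (hΛ.isClosed.preimage dualL.continuous)
  · exact isBounded_iff_forall_norm_le.mpr ⟨a + b, fun z hz =>
      (norm_le_primal_add_dual z).trans (add_le_add (ha _ hz.1) (hb _ hz.2))⟩

end AdaSketch

end

theorem theorem1 {n m : ℕ} (hm : 0 < m)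
    (f : EuclideanSpace ℝ (Fin n) → ℝ)
    (c : EuclideanSpace ℝ (Fin n) → EuclideanSpace ℝ (Fin m))
    (hf : ContDiff ℝ 2 f) (hc : ContDiff ℝ 2 c)
    (p : AdaSketch.Input n m)
    {Ω : Type*} [MeasurableSpace Ω] (P : MeasureTheory.Measure Ω)
    [MeasureTheory.IsProbabilityMeasure P]
    -- the sketching matrices and the modified Hessians
    (S : ℕ → ℕ → Ω → AdaSketch.Sketch n m)
    (B : ℕ → Ω → Matrix (Fin n) (Fin n) ℝ)
    -- the iterates stay in a convex compact set, on which the Hessians are Lipschitz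
    (X : Set (EuclideanSpace ℝ (Fin n))) (Λ : Set (EuclideanSpace ℝ (Fin m)))
    (hXconv : Convex ℝ X) (hXcomp : IsCompact X)
    (hΛconv : Convex ℝ Λ) (hΛcomp : IsCompact Λ)
    (hiter : ∀ᵐ ω ∂P, ∀ k s,
      AdaSketch.run f c p (fun k => B k ω) (fun k j => S k j ω) k = some s →
        AdaSketch.primal s.z ∈ X ∧ AdaSketch.dual s.z ∈ Λ)
    (hfLip : ∃ K, LipschitzOnWith K (fderiv ℝ (fderiv ℝ f)) X)
    (hcLip : ∃ K, LipschitzOnWith K (fderiv ℝ (fderiv ℝ c)) X)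
    -- the Jacobian has full row rank; the modified Hessian is symmetric, bounded, and
    -- positive definite on the null space of the Jacobian, all uniformly
    (ξG ΥB : ℝ) (hξG : 0 < ξG)
    (hreg : ∀ᵐ ω ∂P, ∀ k s,
      AdaSketch.run f c p (fun k => B k ω) (fun k j => S k j ω) k = some s →
        (∀ y : Fin m → ℝ, ξG * (y ⬝ᵥ y) ≤
          y ⬝ᵥ ((AdaSketch.jacobian c (AdaSketch.primal s.z) *
            (AdaSketch.jacobian c (AdaSketch.primal s.z)).transpose).mulVec y)) ∧
        (B k ω).IsSymm ∧
        (∀ u : Fin n → ℝ, (AdaSketch.jacobian c (AdaSketch.primal s.z)).mulVec u = 0 →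
          p.ξB * (u ⬝ᵥ u) ≤ u ⬝ᵥ ((B k ω).mulVec u)) ∧
        AdaSketch.opNorm (B k ω) ≤ ΥB)
    -- the sketching matrices are independent with common law `μ`
    (μ : MeasureTheory.Measure (AdaSketch.Sketch n m))
    (hSmeas : ∀ k j, Measurable (S k j))
    (hSlaw : ∀ k j, P.map (S k j) = μ)
    (hSindep : ProbabilityTheory.iIndepFun (fun q : ℕ × ℕ => S q.1 q.2) P)
    (ϖ : ℝ) (hϖ : ϖ ∈ Set.Ioc (0 : ℝ) 1)
    (hsketch : ∀ u : Fin n ⊕ Fin m → ℝ, u ≠ 0 →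
      ENNReal.ofReal ϖ ≤ μ {s | s.2.transpose.mulVec u ≠ 0}) :
    ∀ᵐ ω ∂P, ∃ s : ℕ → AdaSketch.State n m,
      (∀ k, AdaSketch.run f c p (fun k => B k ω) (fun k j => S k j ω) k = some (s k)) ∧
      Filter.Tendsto (fun k => ‖AdaSketch.gradL f c (s k).z‖) Filter.atTop (nhds 0) := by
  have hμ : ∀ v : AdaSketch.PD n m, v ≠ 0 → μ {s | s.2.transpose.mulVec v.ofLp ≠ 0} ≠ 0 := by
    intro v hv h0
    have h := hsketch v.ofLp fun h => hv (by ext i; exact congrFun h i)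
    rw [h0, nonpos_iff_eq_zero, ENNReal.ofReal_eq_zero] at h
    exact absurd hϖ.1 (not_lt.mpr h)
  have hrec : ∀ᵐ ω ∂P, ∀ k, AdaSketch.Recurrent fun j => S k j ω :=
    MeasureTheory.ae_all_iff.mpr fun k => AdaSketch.ae_recurrent P (S k) μ (hSmeas k) (hSlaw k)
      (hSindep.precomp (g := fun j => (k, j)) fun _ _ h => (Prod.ext_iff.mp h).2) hμ
  filter_upwards [hiter, hreg, hrec] with ω h1 h2 h3
  exact AdaSketch.exists_run_tendsto hm hf hc p _ _
    (AdaSketch.isCompact_primal_dual hXcomp hΛcomp) hξG h1 h2 h3
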